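/- Let $\mathbb{T}^1=\mathbb{R}/\mathbb{Z}$. There are trigonometric polynomials $a_2,a_3,a_4,a_5:\mathbb{T}^1\to\mathbb{C}$ (finite complex linear combinations of the functions $e^{2\pi i n\theta}$, $n\in\mathbb{Z}$), with $a_5\not\equiv 0$, and irrational numbers $\alpha^*,\alpha^{**}$ such that, for the fibred polynomials $$F_\alpha:\mathbb{T}^1\times\mathbb{C}\to\mathbb{T}^1\times\mathbb{C},\qquad F_\alpha(\theta,z)=\bigl(\theta+\alpha,\; z+a_2(\theta)z^2+a_3(\theta)z^3+a_4(\theta)z^4+a_5(\theta)z^5\bigr),$$ $F_{\alpha^*}$ presents a $k$-petal parabolic behaviour for $k=4$ and for no other $k\in\mathbb{N}$, and $F_{\alpha^{**}}$ presents a $k$-petal parabolic behaviour for $k=3$ and for no other $k\in\mathbb{N}$. Thus the number of petals depends on the base rotation number and not only on the complex coordinate of the map. Here the terms have the following meaning. An open tube is an open set $P\subset\mathbb{T}^1\times\mathbb{C}$ that is homeomorphic to $\mathbb{T}^1\times\mathbb{D}$ ($\mathbb{D}$ the open unit disc) by a homeomorphism commuting with the projections to $\mathbb{T}^1$. It is a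 tubular neighbourhood of the curve $\mathcal{Z}=\mathbb{T}^1\times\{0\}$ if the homeomorphism can be chosen so that $(\theta,0)$ corresponds to $(\theta,0)$ for all $\theta$. A fibred attracting petal of a map $G$ is an open tube $P$ such that $0\in\partial P_\theta$ for every fibre $P_\theta=\{z:(\theta,z)\in P\}$, $G(\overline P)\subset P\cup\mathcal{Z}$, and $G^n\to\mathcal{Z}$ uniformly on $P$ as $n\to\infty$ (the second coordinate of $G^n$ tends to $0$ uniformly on $P$). A map $F$ presents a $k$-petal parabolic behaviour if, for some $r>0$ such that $F$ is injective on $T_r=\mathbb{T}^1\times\{|z|<r\}$, there are $k$ pairwise disjoint fibred attracting petals of $F$ with closures in $T_r$ and $k$ pairwise disjoint fibred repelling petals (fibred attracting petals of the local inverse $(F|_{T_r})^{-1}$, with closures in $T_r\cap F(T_r)$), such that the union of these $2k$ petals and $\mathcal{Z}$ is a tubular neighbourhood of $\mathcal{Z}$. -/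

import Mathlib

open Set Filter Topology

/-- The zero section `𝕋¹ × {0}` of `𝕋¹ × ℂ`, where `𝕋¹ = ℝ / ℤ`: the invariant curve. -/
def zeroSection : Set (UnitAddCircle × ℂ) := {p | p.2 = 0}

/-- The open tube `𝕋¹ × D(0, r)`. -/
def tube (r : ℝ) : Set (UnitAddCircle × ℂ) := {p | ‖p.2‖ < r}

/-- The fibre `{z | (θ, z) ∈ S}` of `S` over `θ`. -/
def fibre (S : Set (UnitAddCircle × ℂ)) (θ : UnitAddCircle) : Set ℂ := {z | (θ, z) ∈ S}

/-- `Φ` is a homeomorphism over `𝕋¹`, onto the open set `S`, from the product of `𝕋¹` with the open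
unit disc. -/
def IsDiscTrivialization (Φ : UnitAddCircle × Metric.ball (0 : ℂ) 1 → UnitAddCircle × ℂ)
    (S : Set (UnitAddCircle × ℂ)) : Prop :=
  IsOpenEmbedding Φ ∧ range Φ = S ∧ ∀ p, (Φ p).1 = p.1

/-- `S` is an open tube: its fibres are open topological discs depending continuously on `θ`. -/
def IsDiscTube (S : Set (UnitAddCircle × ℂ)) : Prop :=
  ∃ Φ, IsDiscTrivialization Φ S

/-- `S` is an (open) tubular neighbourhood of the zero section: an open tube, with a
trivialization under which the zero section corresponds to the centres of the discs. -/
def IsTubularNeighbourhood (S : Set (UnitAddCircle × ℂ)) : Prop :=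
  ∃ Φ, IsDiscTrivialization Φ S ∧
    ∀ θ : UnitAddCircle, Φ (θ, ⟨0, Metric.mem_ball_self one_pos⟩) = (θ, 0)

/-- `P` is a fibred attracting petal of `F`: an open tube with the zero section in its fibrewise
boundary, whose closure is mapped by `F` into `P` together with the zero section, and whose forward
iterates converge (uniformly) to the zero section. -/
structure IsAttractingPetal (F : UnitAddCircle × ℂ → UnitAddCircle × ℂ)
    (P : Set (UnitAddCircle × ℂ)) : Prop where
  isDiscTube : IsDiscTube P
  zero_mem_frontier : ∀ θ, (0 : ℂ) ∈ frontier (fibre P θ)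
  mapsTo : MapsTo F (closure P) (P ∪ zeroSection)
  converges : ∀ ε > 0, ∀ᶠ n : ℕ in atTop, ∀ p ∈ P, F^[n] p ∈ tube ε

/-- The local inverse of `F` (with values in the tube of radius `r`, on which `F` is supposed to be
injective); it is meaningful on `F '' tube r`. -/
noncomputable def localInverse (F : UnitAddCircle × ℂ → UnitAddCircle × ℂ) (r : ℝ) :
    UnitAddCircle × ℂ → UnitAddCircle × ℂ :=
  Function.invFunOn F (tube r)

/-- `F` presents a `k` petals parabolic behaviour at the zero section: in some tube on which `F` is
injective there are `k` disjoint fibred attracting petals of `F` and `k` disjoint fibred repelling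
petals of `F` (attracting petals of the local inverse), and these `2k` petals together with the
zero section form a tubular neighbourhood of the zero section. -/
def HasPetals (F : UnitAddCircle × ℂ → UnitAddCircle × ℂ) (k : ℕ) : Prop :=
  ∃ r : ℝ, 0 < r ∧ InjOn F (tube r) ∧
    ∃ P Q : Fin k → Set (UnitAddCircle × ℂ),
      (∀ j, closure (P j) ⊆ tube r ∧ IsAttractingPetal F (P j)) ∧
      (∀ j, closure (Q j) ⊆ tube r ∩ F '' tube r ∧
        IsAttractingPetal (localInverse F r) (Q j)) ∧
      Pairwise (Function.onFun Disjoint P) ∧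
      Pairwise (Function.onFun Disjoint Q) ∧
      IsTubularNeighbourhood (zeroSection ∪ (⋃ j, P j) ∪ ⋃ j, Q j)

/-- Complex trigonometric polynomials on `ℝ / ℤ`: finite linear combinations of the characters
`θ ↦ exp (2 π i n θ)`, `n ∈ ℤ`. -/
def IsTrigPolynomial (a : C(UnitAddCircle, ℂ)) : Prop :=
  a ∈ Submodule.span ℂ (range (fun n : ℤ => (fourier n : C(UnitAddCircle, ℂ))))

/-- The fibred polynomial
`(θ, z) ↦ (θ + α, z + a₂(θ) z² + a₃(θ) z³ + a₄(θ) z⁴ + a₅(θ) z⁵)`. -/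
noncomputable def fibredPolynomial (a₂ a₃ a₄ a₅ : C(UnitAddCircle, ℂ)) (α : ℝ) :
    UnitAddCircle × ℂ → UnitAddCircle × ℂ :=
  fun p => (p.1 + (α : UnitAddCircle),
    p.2 + a₂ p.1 * p.2 ^ 2 + a₃ p.1 * p.2 ^ 3 + a₄ p.1 * p.2 ^ 4 + a₅ p.1 * p.2 ^ 5)

/-! The number of petals is decided by the first obstruction to removing the nonlinear terms by a
fibred change of coordinate, and for a suitable family this obstruction depends on `α`.

Let `h (θ, z) = z + b₂(θ) z² + ...`. Asking that `h` conjugate the map to `z + A z^(k+1)` modulo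
`z^(k+2)`, with constant `A ≠ 0`, gives one cohomological equation `b(θ + α) - b(θ) = A' - g(θ)` per
order, where `A'` is `0` below order `k + 1` and `A` at that order. For `α` irrational and `g` a
trigonometric polynomial it is solved frequency by frequency, and the constant is forced to be the
mean of `g`. Once the normal form is reached, the Leau–Fatou construction in the coordinate `V = (κ
/ h)^k`, where the map is close to `V + 1`, yields `k` attracting and `k` repelling petals
(`hasPetals_of_conjugate`).

The example has `a₂ = e(θ)`, `a₃ = e(-θ)`, `a₄ = u` and `a₅ = 1`, where `e(θ) = exp(2πiθ)`. Orders 2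
and 3 carry no constant term; at order 4 the mean is `u - 2 - 1 / (1 - e(α))` (`exists_conjugacy`).
If it is nonzero there are 3 petals. If it vanishes, order 5 has mean `a₅ = 1` and there are 4.
Choosing `u` to cancel the mean at `√2` leaves it nonzero at `2√2`.

No other `k` can occur because petals have a dynamical meaning: every orbit tending to the zero
section without meeting it is eventually trapped in exactly one attracting petal, and the orbits
from one petal of a second configuration cannot be split between petals of the first
(`HasPetals.le`). -/

lemma IsDiscTube.isOpen {S : Set (UnitAddCircle × ℂ)} (h : IsDiscTube S) : IsOpen S := by
  obtain ⟨Φ, h1, h2, -⟩ := h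
  exact h2 ▸ h1.isOpen_range

lemma isOpen_fibre {S : Set (UnitAddCircle × ℂ)} (h : IsOpen S) (θ : UnitAddCircle) :
    IsOpen (fibre S θ) :=
  h.preimage (Continuous.prodMk_right θ)

lemma IsDiscTube.isPathConnected {S : Set (UnitAddCircle × ℂ)} (h : IsDiscTube S) :
    IsPathConnected S := by
  obtain ⟨Φ, h1, h2, -⟩ := h
  have : PathConnectedSpace (Metric.ball (0 : ℂ) 1) :=
    isPathConnected_iff_pathConnectedSpace.1
      ((convex_ball (0 : ℂ) 1).isPathConnected ⟨0, Metric.mem_ball_self one_pos⟩)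
  exact h2 ▸ isPathConnected_range h1.continuous

lemma IsAttractingPetal.disjoint_zeroSection {F : UnitAddCircle × ℂ → UnitAddCircle × ℂ}
    {P : Set (UnitAddCircle × ℂ)} (h : IsAttractingPetal F P) : Disjoint P zeroSection := by
  refine Set.disjoint_left.2 fun p hp hz => ?_
  have h0 := h.zero_mem_frontier p.1
  rw [(isOpen_fibre h.isDiscTube.isOpen p.1).frontier_eq] at h0
  refine h0.2 ?_
  have hz' : p.2 = 0 := hz
  change (p.1, (0 : ℂ)) ∈ P
  rwa [← hz']

/-- Compactness of the circle gives one radius valid for all fibres. -/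
lemma IsTubularNeighbourhood.exists_tube_subset {S : Set (UnitAddCircle × ℂ)}
    (h : IsTubularNeighbourhood S) : ∃ ε > 0, tube ε ⊆ S := by
  obtain ⟨Φ, ⟨h1, h2, -⟩, h4⟩ := h
  have hopen : IsOpen S := h2 ▸ h1.isOpen_range
  have hsub : (univ : Set UnitAddCircle) ×ˢ ({0} : Set ℂ) ⊆ S := by
    rintro ⟨θ, z⟩ ⟨-, hz⟩
    obtain rfl : z = 0 := hz
    rw [← h4 θ, ← h2]
    exact mem_range_self _
  obtain ⟨u, v, -, hv, hu', hv', huv⟩ :=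
    generalized_tube_lemma isCompact_univ isCompact_singleton hopen hsub
  obtain ⟨ε, hε, hball⟩ := Metric.isOpen_iff.1 hv 0 (hv' rfl)
  refine ⟨ε, hε, fun p hp => huv ⟨hu' (mem_univ _), hball ?_⟩⟩
  exact mem_ball_zero_iff.2 hp

/-! ### Uniqueness of the number of petals -/

section Uniqueness

variable {F : UnitAddCircle × ℂ → UnitAddCircle × ℂ} {k : ℕ} {r : ℝ}

lemma localInverse_apply (hF : InjOn F (tube r)) {p : UnitAddCircle × ℂ} (hp : p ∈ tube r) :
    localInverse F r (F p) = p :=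
  hF.leftInvOn_invFunOn hp

lemma localInverse_iterate (hF : InjOn F (tube r)) {p : UnitAddCircle × ℂ} (n : ℕ)
    (hp : ∀ m, F^[m] p ∈ tube r) : (localInverse F r)^[n] (F^[n] p) = p := by
  induction n with
  | zero => rfl
  | succ n ih =>
    rw [Function.iterate_succ_apply, Function.iterate_succ_apply', localInverse_apply hF (hp n), ih]

/-- A fibred map fixes the zero section if it maps each `(θ, 0)` to a point `(θ', 0)`, where `θ'`
is the base point of the images of the points over `θ`. -/
def FixesZeroSection (F : UnitAddCircle × ℂ → UnitAddCircle × ℂ) : Prop :=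
  ∀ p, F (p.1, 0) = ((F p).1, 0)

lemma FixesZeroSection.notMem (h0 : FixesZeroSection F) (hr : 0 < r) (hF : InjOn F (tube r))
    {p : UnitAddCircle × ℂ} (hp : p ∈ tube r) (hz : p ∉ zeroSection) : F p ∉ zeroSection := by
  intro h
  have h1 : F p = F (p.1, 0) := by
    rw [h0 p]; exact Prod.ext rfl h
  have := hF hp (by simpa [tube] using hr) h1
  exact hz (congrArg Prod.snd this)

lemma IsAttractingPetal.mapsTo_self {P : Set (UnitAddCircle × ℂ)} (h : IsAttractingPetal F P)
    (h0 : FixesZeroSection F) (hr : 0 < r) (hF : InjOn F (tube r)) (hP : closure P ⊆ tube r) :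
    MapsTo F P P := by
  intro p hp
  refine (h.mapsTo (subset_closure hp)).resolve_right ?_
  exact h0.notMem hr hF (hP (subset_closure hp)) (Set.disjoint_left.1 h.disjoint_zeroSection hp)

/-- A compact connected set disjoint from the zero section, whose iterates converge uniformly to
the zero section, ends up in one of the attracting petals. -/
lemma exists_petal_of_converges (hc : Continuous F) (h0 : FixesZeroSection F) (hr : 0 < r)
    (hF : InjOn F (tube r)) {P Q : Fin k → Set (UnitAddCircle × ℂ)}
    (hP : ∀ j, closure (P j) ⊆ tube r ∧ IsAttractingPetal F (P j))
    (hQ : ∀ j, IsAttractingPetal (localInverse F r) (Q j))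
    (hPd : Pairwise (Function.onFun Disjoint P))
    (hT : IsTubularNeighbourhood (zeroSection ∪ (⋃ j, P j) ∪ ⋃ j, Q j))
    {K : Set (UnitAddCircle × ℂ)} (hK : IsCompact K) (hKc : IsConnected K)
    (hKz : ∀ n, ∀ p ∈ K, F^[n] p ∉ zeroSection)
    (hKt : ∀ ε > 0, ∀ᶠ n : ℕ in atTop, ∀ p ∈ K, F^[n] p ∈ tube ε) :
    ∃ j, ∀ᶠ n : ℕ in atTop, ∀ p ∈ K, F^[n] p ∈ P j := by
  obtain ⟨ε, hε, hsub⟩ := hT.exists_tube_subset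
  obtain ⟨n₀, hn₀⟩ := eventually_atTop.1 ((hKt ε hε).and (hKt r hr))
  have hcn : ∀ n, Continuous (F^[n]) := fun n => hc.iterate n
  obtain ⟨δ, hδ, hδK⟩ : ∃ δ > 0, ∀ p ∈ K, δ ≤ ‖(F^[n₀] p).2‖ := by
    obtain ⟨p, hp, hmin⟩ := hK.exists_isMinOn hKc.nonempty
      (f := fun p => ‖(F^[n₀] p).2‖) ((hcn n₀).snd.norm.continuousOn)
    exact ⟨_, norm_pos_iff.2 (hKz n₀ p hp), fun q hq => hmin hq⟩
  -- `M` inverse steps bring every repelling petal within `δ` of the zero section. A point of `K`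
  -- lying in a repelling petal at time `M + n₀` would therefore have been within `δ` at time `n₀`,
  -- against the choice of `δ`.
  obtain ⟨M, hM⟩ := eventually_atTop.1
    (eventually_all.2 fun j => (hQ j).converges δ hδ)
  have hmem : ∀ p ∈ K, F^[M + n₀] p ∈ ⋃ j, P j := by
    intro p hp
    rcases hsub ((hn₀ (M + n₀) (by lia)).1 p hp) with (h | h) | h
    · exact absurd h (hKz _ p hp)
    · exact h
    · obtain ⟨j, hj⟩ := mem_iUnion.1 h
      have h1 := hM M le_rfl j _ hj
      rw [Function.iterate_add_apply, localInverse_iterate hF M] at h1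
      · exact absurd (show ‖(F^[n₀] p).2‖ < δ from h1) (not_lt.2 (hδK p hp))
      · intro m
        rw [← Function.iterate_add_apply]
        exact (hn₀ (m + n₀) (by lia)).2 p hp
  obtain ⟨p₀, hp₀⟩ := hKc.nonempty
  obtain ⟨j, hj⟩ := mem_iUnion.1 (hmem p₀ hp₀)
  have hone : ∀ p ∈ K, F^[M + n₀] p ∈ P j := by
    have hpre := (hKc.image _ (hcn (M + n₀)).continuousOn).isPreconnected
    have := hpre.subset_left_of_subset_union (u := P j) (v := ⋃ i, ⋃ _ : i ≠ j, P i)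
      (hP j).2.isDiscTube.isOpen
      (isOpen_iUnion fun i => isOpen_iUnion fun _ => (hP i).2.isDiscTube.isOpen)
      (by
        simp only [disjoint_iUnion_right]
        exact fun i hi => hPd hi.symm)
      (by
        rintro _ ⟨p, hp, rfl⟩
        obtain ⟨i, hi⟩ := mem_iUnion.1 (hmem p hp)
        by_cases h : i = j
        · exact Or.inl (h ▸ hi)
        · exact Or.inr (mem_iUnion₂.2 ⟨i, h, hi⟩))
      ⟨_, mem_image_of_mem _ hp₀, hj⟩
    exact fun p hp => this (mem_image_of_mem _ hp)
  refine ⟨j, eventually_atTop.2 ⟨M + n₀, fun n hn p hp => ?_⟩⟩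
  obtain ⟨m, rfl⟩ := Nat.exists_eq_add_of_le' hn
  rw [Function.iterate_add_apply]
  exact ((hP j).2.mapsTo_self h0 hr hF (hP j).1).iterate m (hone p hp)

/-- The number of petals of a parabolic behaviour is at most that of any other one. -/
lemma HasPetals.le (hc : Continuous F) (h0 : FixesZeroSection F) {l : ℕ}
    (hk : HasPetals F k) (hl : HasPetals F l) : k ≤ l := by
  obtain ⟨r, hr, hF, P, Q, hP, hQ, hPd, -, hT⟩ := hk
  obtain ⟨s, hs, hF', P', Q', hP', hQ', hPd', -, hT'⟩ := hl
  have inv : ∀ j, MapsTo F (P j) (P j) := fun j => (hP j).2.mapsTo_self h0 hr hF (hP j).1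
  have inv' : ∀ j, MapsTo F (P' j) (P' j) := fun j => (hP' j).2.mapsTo_self h0 hs hF' (hP' j).1
  have key : ∀ j, ∀ p ∈ P j, ∃ j', ∀ᶠ n : ℕ in atTop, F^[n] p ∈ P' j' := by
    intro j p hp
    obtain ⟨j', hj'⟩ := exists_petal_of_converges hc h0 hs hF' hP' (fun j => (hQ' j).2) hPd' hT'
      (K := {p}) isCompact_singleton isConnected_singleton
      (fun n q hq => by
        rw [mem_singleton_iff.1 hq]
        exact Set.disjoint_left.1 (hP j).2.disjoint_zeroSection ((inv j).iterate n hp))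
      (fun ε hε => ((hP j).2.converges ε hε).mono fun n hn q hq => by
        rw [mem_singleton_iff.1 hq]; exact hn p hp)
    exact ⟨j', hj'.mono fun n hn => hn p rfl⟩
  -- Two points of `P' j'` are joined by a path inside it; the path is compact and connected, so it
  -- is absorbed as a whole by one petal of the first family.
  have single : ∀ j', ∀ p ∈ P' j', ∀ q ∈ P' j', ∃ j, ∀ᶠ n : ℕ in atTop,
      F^[n] p ∈ P j ∧ F^[n] q ∈ P j := by
    intro j' p hp q hq
    obtain ⟨γ, hγ⟩ := (hP' j').2.isDiscTube.isPathConnected.joinedIn p hp q hq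
    obtain ⟨j, hj⟩ := exists_petal_of_converges hc h0 hr hF hP (fun j => (hQ j).2) hPd hT
      (K := range γ) (isCompact_range γ.continuous) (isConnected_range γ.continuous)
      (by
        rintro n _ ⟨t, rfl⟩
        exact Set.disjoint_left.1 (hP' j').2.disjoint_zeroSection ((inv' j').iterate n (hγ t)))
      (fun ε hε => ((hP' j').2.converges ε hε).mono fun n hn => by
        rintro _ ⟨t, rfl⟩; exact hn _ (hγ t))
    exact ⟨j, hj.mono fun n hn => ⟨hn _ ⟨0, γ.source⟩, hn _ ⟨1, γ.target⟩⟩⟩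
  have hne : ∀ j, (P j).Nonempty := fun j => (hP j).2.isDiscTube.isPathConnected.nonempty
  choose p hp using hne
  choose f hf using fun j => key j (p j) (hp j)
  -- If the orbits from `P i` and `P j` reach the same `P'`, they end in a common `P a`; each `P`
  -- being invariant and the family disjoint, `i = a = j`.
  have hinj : Function.Injective f := by
    intro i j hij
    have hf' := (hf i).and (hij ▸ hf j)
    obtain ⟨n, hn, hn'⟩ := hf'.exists
    obtain ⟨a, ha⟩ := single (f i) _ hn _ hn'
    obtain ⟨m, hm, hm'⟩ := ha.exists
    rw [← Function.iterate_add_apply] at hm hm'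
    have e : ∀ i a, F^[m + n] (p i) ∈ P a → i = a := fun i a h => by
      by_contra hne
      exact Set.disjoint_left.1 (hPd hne) ((inv i).iterate (m + n) (hp i)) h
    rw [e i a hm, e j a hm']
  simpa using Fintype.card_le_of_injective f hinj

end Uniqueness

/-! ### Planar petals in the coordinate `V = (κ / w)^k` -/

/-- The region to the right of the cone with apex `R` and sides of slope `±1`. -/
def coneComplement (R : ℝ) : Set ℂ := {V | R < V.re + |V.im|}

/-- The branch of `V ^ (-1 / k)` on the slit plane. -/
noncomputable def invRoot (k : ℕ) (V : ℂ) : ℂ := Complex.exp (-Complex.log V / k)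

/-- The branch of the preimage of `coneComplement R` under `w ↦ (κ / w) ^ k` bisected by the ray
through `κ`. -/
noncomputable def planarPetal (k : ℕ) (κ : ℂ) (R : ℝ) : Set ℂ :=
  (fun V => κ * invRoot k V) '' coneComplement R

lemma mem_slitPlane_of_le {R : ℝ} (hR : 0 < R) {V : ℂ} (h : R ≤ V.re + |V.im|) :
    V ∈ Complex.slitPlane := by
  rw [Complex.mem_slitPlane_iff]
  by_cases hi : V.im = 0
  · left; simp [hi] at h; linarith
  · exact Or.inr hi

lemma le_two_mul_norm (V : ℂ) : V.re + |V.im| ≤ 2 * ‖V‖ := by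
  linarith [Complex.re_le_norm V, Complex.abs_im_le_norm V]

lemma invRoot_ne_zero (k : ℕ) (V : ℂ) : invRoot k V ≠ 0 := Complex.exp_ne_zero _

lemma invRoot_pow {k : ℕ} (hk : k ≠ 0) {V : ℂ} (hV : V ≠ 0) : invRoot k V ^ k = V⁻¹ := by
  rw [invRoot, ← Complex.exp_nat_mul, mul_div_cancel₀ _ (by exact_mod_cast hk), Complex.exp_neg,
    Complex.exp_log hV]

lemma div_mul_invRoot_pow {k : ℕ} (hk : k ≠ 0) {κ V : ℂ} (hκ : κ ≠ 0) (hV : V ≠ 0) :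
    (κ / (κ * invRoot k V)) ^ k = V := by
  rw [div_mul_cancel_left₀ hκ, inv_pow, invRoot_pow hk hV, inv_inv]

/-- On each horizontal line the region is an open half-line starting at `R - |Im|`, which `exp`
parametrizes by the whole real line. -/
lemma isOpenEmbedding_shear (R : ℝ) :
    ∃ φ : ℂ → ℂ, IsOpenEmbedding φ ∧ range φ = coneComplement R := by
  let e : OpenPartialHomeomorph ℂ ℂ :=
    { toFun := fun z => ((Real.exp z.re + R - |z.im| : ℝ) : ℂ) + (z.im : ℂ) * Complex.I
      invFun := fun V => ((Real.log (V.re + |V.im| - R) : ℝ) : ℂ) + (V.im : ℂ) * Complex.I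
      source := univ
      target := coneComplement R
      map_source' := fun z _ => by
        simp [coneComplement, Complex.exp_ofReal_re, Real.exp_pos]
      map_target' := fun _ _ => mem_univ _
      left_inv' := fun z _ => by
        apply Complex.ext <;> simp [Complex.exp_ofReal_re]
      right_inv' := fun V hV => by
        have hV' : 0 < V.re + |V.im| - R := sub_pos.2 hV
        apply Complex.ext <;> simp [Real.exp_log hV']
      open_source := isOpen_univ
      open_target := isOpen_lt continuous_const
        (Complex.continuous_re.add Complex.continuous_im.abs)
      continuousOn_toFun := by fun_prop
      continuousOn_invFun := by
        refine ContinuousOn.add (Complex.continuous_ofReal.comp_continuousOn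
          (ContinuousOn.log (by fun_prop) fun V hV => (sub_pos.2 hV).ne')) (by fun_prop) }
  refine ⟨e, e.isOpenEmbedding rfl, ?_⟩
  rw [← image_univ]
  exact e.image_source_eq_target

lemma exists_planarPetal_embedding {k : ℕ} (hk : k ≠ 0) {κ : ℂ} (hκ : κ ≠ 0) {R : ℝ} (hR : 0 < R) :
    ∃ φ : Metric.ball (0 : ℂ) 1 → ℂ, IsOpenEmbedding φ ∧ range φ = planarPetal k κ R := by
  obtain ⟨χ, hχ, hχr⟩ := isOpenEmbedding_shear R
  have hmem : ∀ z, χ z ∈ Complex.slitPlane := fun z =>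
    mem_slitPlane_of_le hR (by
      have : χ z ∈ coneComplement R := hχr ▸ mem_range_self z
      exact le_of_lt this)
  have hk' : (-(k : ℂ)⁻¹) ≠ 0 := neg_ne_zero.2 (inv_ne_zero (by exact_mod_cast hk))
  let e : OpenPartialHomeomorph ℂ ℂ :=
    (hχ.toOpenPartialHomeomorph χ).trans <| Complex.expOpenPartialHomeomorph.symm.trans <|
      (Homeomorph.mulLeft₀ (-(k : ℂ)⁻¹) hk').toOpenPartialHomeomorph.trans <|
      Complex.expOpenPartialHomeomorph.trans (Homeomorph.mulLeft₀ κ hκ).toOpenPartialHomeomorph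
  have he : ∀ z, e z = κ * invRoot k (χ z) := fun z => by
    change κ * Complex.exp (-(k : ℂ)⁻¹ * Complex.log (χ z)) = _
    rw [invRoot]
    congr 2
    field_simp
  have hs : e.source = univ := by
    refine eq_univ_of_forall fun z => ?_
    -- On this strip `exp` is injective, so the branch of `V^(-1/k)` is an open embedding.
    have h1 : (-(k : ℂ)⁻¹ * Complex.log (χ z)).im ∈ Ioo (-Real.pi) Real.pi := by
      have h2 : (-(k : ℂ)⁻¹ * Complex.log (χ z)).im = -((k : ℝ)⁻¹ * (χ z).arg) := by
        rw [neg_mul, Complex.neg_im, ← Complex.ofReal_natCast, ← Complex.ofReal_inv,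
          Complex.im_ofReal_mul, Complex.log_im]
      have h3 : |(χ z).arg| < Real.pi := by
        exact abs_lt.2 ⟨Complex.neg_pi_lt_arg _,
          Complex.arg_lt_pi_iff.2 ((hmem z).imp le_of_lt id)⟩
      have h4 : (k : ℝ)⁻¹ ≤ 1 := inv_le_one_of_one_le₀ (by exact_mod_cast Nat.one_le_iff_ne_zero.2 hk)
      have h5 : |(k : ℝ)⁻¹ * (χ z).arg| < Real.pi := by
        rw [abs_mul, abs_of_nonneg (by positivity)]
        nlinarith [abs_nonneg (χ z).arg]
      rw [h2]
      have := abs_lt.1 h5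
      exact ⟨by linarith [this.2], by linarith [this.1]⟩
    simp only [e, OpenPartialHomeomorph.trans_source, mem_inter_iff, mem_preimage]
    refine ⟨by simp, hmem z, by simp, h1, by simp⟩
  refine ⟨e ∘ Homeomorph.unitBall.symm,
    (e.isOpenEmbedding hs).comp Homeomorph.unitBall.symm.isOpenEmbedding, ?_⟩
  rw [range_comp, Homeomorph.unitBall.symm.surjective.range_eq, image_univ, planarPetal, ← hχr,
    ← range_comp]
  exact congrArg range (funext he)

lemma planarPetal_spec {k : ℕ} (hk : k ≠ 0) {κ : ℂ} (hκ : κ ≠ 0) {R : ℝ} (hR : 0 < R) {w : ℂ}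
    (hw : w ∈ planarPetal k κ R) :
    w ≠ 0 ∧ (κ / w) ^ k ∈ coneComplement R ∧ w = κ * invRoot k ((κ / w) ^ k) := by
  obtain ⟨V, hV, rfl⟩ := hw
  have h0 := Complex.slitPlane_ne_zero (mem_slitPlane_of_le hR (le_of_lt hV))
  simp only [div_mul_invRoot_pow hk hκ h0]
  exact ⟨mul_ne_zero hκ (invRoot_ne_zero _ _), hV, trivial⟩

/-- The nonstrict inequality with `R > 0` still keeps `V` off the cut, so the choice of branch
passes to the limit. Needed because a petal must absorb the image of its closure. -/
lemma planarPetal_closure {k : ℕ} (hk : k ≠ 0) {κ : ℂ} (hκ : κ ≠ 0) {R : ℝ} (hR : 0 < R) {w : ℂ}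
    (hw : w ∈ closure (planarPetal k κ R)) (h0 : w ≠ 0) :
    R ≤ ((κ / w) ^ k).re + |((κ / w) ^ k).im| ∧ w = κ * invRoot k ((κ / w) ^ k) := by
  obtain ⟨x, hx, hlim⟩ := mem_closure_iff_seq_limit.1 hw
  have hV : Tendsto (fun n => (κ / x n) ^ k) atTop (𝓝 ((κ / w) ^ k)) :=
    (tendsto_const_nhds.div hlim h0).pow k
  have h1 : R ≤ ((κ / w) ^ k).re + |((κ / w) ^ k).im| := by
    refine ge_of_tendsto' (((Complex.continuous_re.add Complex.continuous_im.abs).tendsto _).comp hV)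
      fun n => le_of_lt (planarPetal_spec hk hκ hR (hx n)).2.1
  refine ⟨h1, tendsto_nhds_unique hlim ?_⟩
  have h2 : ContinuousAt (fun V => κ * invRoot k V) ((κ / w) ^ k) := by
    have := continuousAt_clog (mem_slitPlane_of_le hR h1)
    unfold invRoot
    fun_prop
  refine (h2.tendsto.comp hV).congr fun n => ?_
  exact (planarPetal_spec hk hκ hR (hx n)).2.2.symm

lemma planarPetal_norm_lt {k : ℕ} (hk : k ≠ 0) {κ : ℂ} (hκ : κ ≠ 0) {R ρ : ℝ} (hρ : 0 < ρ)
    (hR : 2 * (‖κ‖ / ρ) ^ k ≤ R) : planarPetal k κ R ⊆ Metric.ball 0 ρ := by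
  intro w hw
  have hR0 : 0 < R := lt_of_lt_of_le (by positivity) hR
  obtain ⟨h0, hV, -⟩ := planarPetal_spec hk hκ hR0 hw
  have h1 : (‖κ‖ / ρ) ^ k < (‖κ‖ / ‖w‖) ^ k := by
    have h2 := le_two_mul_norm ((κ / w) ^ k)
    rw [norm_pow, norm_div] at h2
    have h3 : R < _ := hV
    linarith
  have h2 := lt_of_pow_lt_pow_left₀ k (by positivity) h1
  rw [mem_ball_zero_iff]
  have hκ' := norm_pos_iff.2 hκ
  exact (div_lt_div_iff_of_pos_left hκ' hρ (norm_pos_iff.2 h0)).1 h2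

lemma zero_mem_closure_planarPetal {k : ℕ} (hk : k ≠ 0) {κ : ℂ} (hκ : κ ≠ 0) {R : ℝ} :
    0 ∈ closure (planarPetal k κ R) := by
  rw [Metric.mem_closure_iff]
  intro ε hε
  set S := max (max R 0 + 1) (2 * (‖κ‖ / ε) ^ k)
  have hS : max R 0 + 1 ≤ S := le_max_left _ _
  have hS' : ((S + 1 : ℝ) : ℂ) ∈ coneComplement S := by
    simp [coneComplement]
  refine ⟨κ * invRoot k ((S + 1 : ℝ) : ℂ), ⟨_, ?_, rfl⟩, ?_⟩
  · have h2 : S < _ := hS'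
    exact lt_trans (by linarith [le_max_left R 0]) h2
  · have := planarPetal_norm_lt hk hκ hε (le_max_right _ _ : _ ≤ S) ⟨_, hS', rfl⟩
    rwa [dist_comm]

/-- `V` determines `w` only up to a `k`-th root of unity; this gap lets a small displacement decide
which petal the image lies in. -/
lemma exists_root_separation {k : ℕ} (hk : k ≠ 0) :
    ∃ δ > 0, ∀ ξ : ℂ, ξ ^ k = 1 → ‖ξ - 1‖ < δ → ξ = 1 := by
  have hfin : {ξ : ℂ | ξ ^ k = 1}.Finite := by
    have : {ξ : ℂ | ξ ^ k = 1} ⊆ (Polynomial.nthRoots k (1 : ℂ)).toFinset := fun ξ hξ => by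
      simpa [Polynomial.mem_nthRoots (Nat.pos_of_ne_zero hk)] using hξ
    exact (Finset.finite_toSet _).subset this
  have hcl : IsClosed ({ξ : ℂ | ξ ^ k = 1} \ {1}) := (hfin.subset sdiff_subset).isClosed
  obtain ⟨δ, hδ, h⟩ := Metric.isOpen_iff.1 hcl.isOpen_compl 1 (by simp)
  refine ⟨δ, hδ, fun ξ hξ hd => ?_⟩
  by_contra hne
  exact h (mem_ball_iff_norm.2 hd) ⟨hξ, hne⟩

/-- Along the segment from `V` to `V'` the quantity `Re + |Im|` stays at least `R`. The segment thus
avoids the cut and stays at distance `R / 2` from the origin, where the derivative of `log` is at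
most `2 / R`. -/
lemma norm_log_sub_log_le {R : ℝ} (hR : 0 < R) {V V' : ℂ} (hV : R ≤ V.re + |V.im|)
    (hVV : ‖V' - V - 1‖ ≤ 1 / 4) : ‖Complex.log V' - Complex.log V‖ ≤ 5 / (2 * R) := by
  have hd : ‖V' - V‖ ≤ 5 / 4 := by
    calc ‖V' - V‖ = ‖(V' - V - 1) + 1‖ := by ring_nf
      _ ≤ 1 / 4 + 1 := (norm_add_le _ _).trans (by simpa using hVV)
      _ = 5 / 4 := by norm_num
  have hre := (abs_le.1 ((Complex.abs_re_le_norm _).trans hVV)).1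
  have him := (Complex.abs_im_le_norm _).trans hVV
  simp only [Complex.sub_re, Complex.one_re, Complex.sub_im, Complex.one_im, sub_zero] at hre him
  have hseg : ∀ t ∈ Icc (0 : ℝ) 1,
      R ≤ (V + (t : ℂ) * (V' - V)).re + |(V + (t : ℂ) * (V' - V)).im| := by
    intro t ht
    have h1 : |V.im| - t * |V'.im - V.im| ≤ |V.im + t * (V'.im - V.im)| := by
      have := abs_sub_abs_le_abs_sub V.im (-(t * (V'.im - V.im)))
      rw [abs_neg, abs_mul, abs_of_nonneg ht.1, sub_neg_eq_add] at this
      exact this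
    simp only [Complex.add_re, Complex.add_im, Complex.re_ofReal_mul, Complex.im_ofReal_mul,
      Complex.sub_re, Complex.sub_im]
    nlinarith [ht.1, ht.2]
  have key := norm_image_sub_le_of_norm_deriv_le_segment_01'
    (f := fun t : ℝ => Complex.log (V + (t : ℂ) * (V' - V)))
    (f' := fun t : ℝ => (V' - V) / (V + (t : ℂ) * (V' - V))) (C := 5 / (2 * R))
    (fun t ht => by
      have h1 : HasDerivAt (fun t : ℝ => V + (t : ℂ) * (V' - V)) (V' - V) t := by
        simpa using ((Complex.ofRealCLM.hasDerivAt (x := t)).mul_const (V' - V)).const_add V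
      exact (h1.clog_real (mem_slitPlane_of_le hR (hseg t ht))).hasDerivWithinAt)
    (fun t ht => by
      have h1 := hseg t ⟨ht.1, ht.2.le⟩
      have h2 := le_two_mul_norm (V + (t : ℂ) * (V' - V))
      have h3 : R / 2 ≤ ‖V + (t : ℂ) * (V' - V)‖ := by linarith
      rw [norm_div]
      calc _ ≤ (5 / 4) / (R / 2) := by gcongr
        _ = 5 / (2 * R) := by field_simp; norm_num)
  simpa using key

/-- A point of the closure of a petal is mapped into the petal by any map that changes it by a
small factor and is close to the translation by `1` in the coordinate `(κ / w) ^ k`. -/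
lemma exists_petal_step {k : ℕ} (hk : k ≠ 0) : ∃ δ > 0, ∃ R₀ > 0, ∀ R ≥ R₀, ∀ κ w w' : ℂ,
    κ ≠ 0 → w ∈ closure (planarPetal k κ R) → w ≠ 0 → w' ≠ 0 → ‖w' - w‖ ≤ δ * ‖w‖ →
    ‖(κ / w') ^ k - (κ / w) ^ k - 1‖ ≤ 1 / 4 → w' ∈ planarPetal k κ R := by
  obtain ⟨η, hη, hsep⟩ := exists_root_separation hk
  -- The ratio tested below is `(1 + a)(1 + b)` with `‖a‖ ≤ min (η / 4) 1` and `‖b‖ ≤ η / 4`, hence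
  -- within `3η / 4` of `1`. The bound `20 / η` on `R` controls `b`, and `3` keeps `‖x‖ ≤ 1`.
  refine ⟨min (η / 4) 1, by positivity, max 3 (20 / η), by positivity, ?_⟩
  intro R hR κ w w' hκ hw h0 h0' hww hVV
  have hR3 : 3 ≤ R := (le_max_left _ _).trans hR
  have hRη : 20 / η ≤ R := (le_max_right _ _).trans hR
  have hR0 : 0 < R := by linarith
  obtain ⟨hV, hweq⟩ := planarPetal_closure hk hκ hR0 hw h0
  set V := (κ / w) ^ k with hVdef
  set V' := (κ / w') ^ k with hVdef'
  have hV' : V' ∈ coneComplement R := by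
    have hre := (abs_le.1 ((Complex.abs_re_le_norm _).trans hVV)).1
    have him := (Complex.abs_im_le_norm _).trans hVV
    simp only [Complex.sub_re, Complex.one_re, Complex.sub_im, Complex.one_im, sub_zero] at hre him
    have := abs_sub_abs_le_abs_sub V.im V'.im
    rw [abs_sub_comm] at this
    change R < V'.re + |V'.im|
    linarith
  have hlog := norm_log_sub_log_le hR0 hV hVV
  set x : ℂ := (Complex.log V' - Complex.log V) / k with hx
  have hk1 : (1 : ℝ) ≤ k := by exact_mod_cast Nat.one_le_iff_ne_zero.2 hk
  have hxn : ‖x‖ ≤ 5 / (2 * R) := by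
    rw [hx, norm_div, Complex.norm_natCast]
    exact (div_le_self (norm_nonneg _) hk1).trans hlog
  have hx1 : ‖x‖ ≤ 1 := hxn.trans (by rw [div_le_one (by positivity)]; linarith)
  have hexp := Complex.norm_exp_sub_one_le hx1
  have hexp' : ‖Complex.exp x - 1‖ ≤ η / 4 := by
    refine hexp.trans ?_
    have : 5 / (2 * R) ≤ η / 8 := by
      rw [div_le_div_iff₀ (by positivity) (by norm_num)]
      rw [div_le_iff₀ hη] at hRη
      linarith
    linarith
  have hrat : invRoot k V = invRoot k V' * Complex.exp x := by
    rw [invRoot, invRoot, ← Complex.exp_add, hx]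
    ring_nf
  have hi := invRoot_ne_zero k V'
  have hi0 := invRoot_ne_zero k V
  have hV0 := Complex.slitPlane_ne_zero (mem_slitPlane_of_le hR0 hV'.le)
  have hξ : w' / (κ * invRoot k V') = 1 := by
    refine hsep _ ?_ ?_
    · rw [div_pow, mul_pow, invRoot_pow hk hV0, hVdef', div_pow]
      field_simp
    · set a := (w' - w) / w with ha
      set b := Complex.exp x - 1 with hb
      have han : ‖a‖ ≤ min (η / 4) 1 := by
        rw [ha, norm_div]
        exact div_le_of_le_mul₀ (norm_nonneg _) (by positivity) hww
      have h1 : w' / (κ * invRoot k V') = (1 + a) * (1 + b) := by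
        have e1 : 1 + a = w' / w := by rw [ha]; field_simp; ring
        have e2 : w = κ * (invRoot k V' * Complex.exp x) := by rw [← hrat]; exact hweq
        have e3 : 1 + b = Complex.exp x := by rw [hb]; ring
        rw [e1, e3, e2]
        have := Complex.exp_ne_zero x
        field_simp
      have h2 : w' / (κ * invRoot k V') - 1 = a + b + a * b := by rw [h1]; ring
      have h3 : ‖a * b‖ ≤ 1 * ‖b‖ := by
        rw [norm_mul]
        exact mul_le_mul_of_nonneg_right (han.trans (min_le_right _ _)) (norm_nonneg _)
      rw [h2]
      have h4 := norm_add₃_le (a := a) (b := b) (c := a * b)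
      have h5 := han.trans (min_le_left _ _)
      linarith
  refine ⟨V', hV', ?_⟩
  exact ((div_eq_one_iff_eq (mul_ne_zero hκ hi)).1 hξ).symm

/-! ### The flower formed by all the planar petals -/

lemma continuous_radial {m : ℂ → ℝ} {c : ℝ} (hm : ∀ u ≠ 0, ContinuousAt m u)
    (hle : ∀ u ≠ 0, |m u| ≤ c) : Continuous fun u => (m u : ℂ) * u := by
  rw [continuous_iff_continuousAt]
  intro u
  by_cases hu : u = 0
  · subst hu
    have hlim : Tendsto (fun u : ℂ => c * ‖u‖) (𝓝 0) (𝓝 0) :=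
      Continuous.tendsto' (by fun_prop) _ _ (by simp)
    rw [ContinuousAt, mul_zero]
    refine squeeze_zero_norm (fun u => ?_) hlim
    by_cases hu : u = 0
    · simp [hu]
    · rw [norm_mul, Complex.norm_real, Real.norm_eq_abs]
      gcongr
      exact hle u hu
  · exact (Complex.continuous_ofReal.continuousAt.comp (hm u hu)).mul continuousAt_id

/-- A domain that is star-shaped about the origin, with a continuous radial function `m`, is an
open disc. -/
lemma exists_starShaped_embedding {m : ℂ → ℝ} {a b : ℝ} (ha : 0 < a)
    (hm : ∀ u ≠ 0, ContinuousAt m u) (hal : ∀ u ≠ 0, a ≤ m u) (hmb : ∀ u ≠ 0, m u ≤ b)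
    (hhom : ∀ t : ℝ, 0 < t → ∀ u, m (t * u) = m u) :
    ∃ φ : Metric.ball (0 : ℂ) 1 → ℂ, IsOpenEmbedding φ ∧
      range φ = {w | w = 0 ∨ ‖w‖ < m w} ∧ φ ⟨0, Metric.mem_ball_self one_pos⟩ = 0 := by
  have hpos : ∀ u ≠ 0, 0 < m u := fun u hu => ha.trans_le (hal u hu)
  have hinv : ∀ u ≠ 0, 0 < (m u)⁻¹ := fun u hu => inv_pos.2 (hpos u hu)
  let e : ℂ ≃ₜ ℂ :=
    { toFun := fun u => (m u : ℂ) * u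
      invFun := fun w => ((m w)⁻¹ : ℝ) * w
      left_inv := fun u => by
        by_cases hu : u = 0
        · simp [hu]
        · simp only [hhom _ (hpos u hu)]
          rw [← mul_assoc, ← Complex.ofReal_mul, inv_mul_cancel₀ (hpos u hu).ne']
          simp
      right_inv := fun u => by
        by_cases hu : u = 0
        · simp [hu]
        · simp only [hhom _ (hinv u hu)]
          rw [← mul_assoc, ← Complex.ofReal_mul, mul_inv_cancel₀ (hpos u hu).ne']
          simp
      continuous_toFun := continuous_radial (c := b) hm fun u hu => by
        rw [abs_of_pos (hpos u hu)]; exact hmb u hu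
      continuous_invFun := continuous_radial (c := a⁻¹)
        (fun u hu => (hm u hu).inv₀ (hpos u hu).ne') fun u hu => by
        rw [abs_of_pos (hinv u hu)]
        exact inv_anti₀ ha (hal u hu) }
  refine ⟨fun u => e u, e.isOpenEmbedding.comp Metric.isOpen_ball.isOpenEmbedding_subtypeVal,
    ?_, by simp [e]⟩
  have : range (fun u : Metric.ball (0 : ℂ) 1 => e u) = e '' Metric.ball 0 1 :=
    (range_comp e Subtype.val).trans (by rw [Subtype.range_coe])
  rw [this, e.image_eq_preimage_symm]
  ext w
  change ((m w)⁻¹ : ℝ) * w ∈ Metric.ball (0 : ℂ) 1 ↔ _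
  by_cases hw : w = 0
  · simp [hw]
  · rw [mem_ball_zero_iff, norm_mul, Complex.norm_real, Real.norm_of_nonneg (hinv w hw).le,
      inv_mul_lt_iff₀ (hpos w hw), mul_one]
    simp [hw]

/-- The union of the attracting and the repelling planar petals, with the origin. -/
lemma exists_flower_embedding {k : ℕ} (hk : k ≠ 0) {κ : ℂ} (hκ : κ ≠ 0) {R : ℝ} (hR : 0 < R) :
    ∃ φ : Metric.ball (0 : ℂ) 1 → ℂ, IsOpenEmbedding φ ∧
      range φ = {w | w = 0 ∨ R < |((κ / w) ^ k).re| + |((κ / w) ^ k).im|} ∧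
      φ ⟨0, Metric.mem_ball_self one_pos⟩ = 0 := by
  set N : ℂ → ℝ := fun w => |((κ / w) ^ k).re| + |((κ / w) ^ k).im| with hN
  -- `N` is homogeneous of degree `-k`, so `N w * ‖w‖ ^ k` depends only on the direction of `w`, and
  -- `R < N w` becomes `‖w‖ < m w`.
  set m : ℂ → ℝ := fun w => (N w * ‖w‖ ^ k / R) ^ ((k : ℝ)⁻¹) with hm
  have hκ' := norm_pos_iff.2 hκ
  have hk' : (0 : ℝ) < (k : ℝ)⁻¹ := by
    have : (0 : ℝ) < k := by exact_mod_cast Nat.pos_of_ne_zero hk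
    positivity
  have hNnn : ∀ w, 0 ≤ N w := fun w => by positivity
  have hlow : ∀ w ≠ 0, ‖κ‖ ^ k ≤ N w * ‖w‖ ^ k := fun w hw => by
    have h1 : ‖(κ / w) ^ k‖ ≤ N w := Complex.norm_le_abs_re_add_abs_im _
    rw [norm_pow, norm_div, div_pow] at h1
    have := norm_pos_iff.2 hw
    rwa [div_le_iff₀ (by positivity)] at h1
  have hupp : ∀ w ≠ 0, N w * ‖w‖ ^ k ≤ 2 * ‖κ‖ ^ k := fun w hw => by
    have h1 : N w ≤ 2 * ‖(κ / w) ^ k‖ := by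
      have := Complex.abs_re_le_norm ((κ / w) ^ k)
      have := Complex.abs_im_le_norm ((κ / w) ^ k)
      simp only [hN]
      linarith
    rw [norm_pow, norm_div, div_pow] at h1
    have := norm_pos_iff.2 hw
    calc N w * ‖w‖ ^ k ≤ 2 * (‖κ‖ ^ k / ‖w‖ ^ k) * ‖w‖ ^ k := by gcongr
      _ = _ := by field_simp
  obtain ⟨φ, hφ, hr, h0⟩ := exists_starShaped_embedding (m := m)
    (a := (‖κ‖ ^ k / R) ^ ((k : ℝ)⁻¹)) (b := (2 * ‖κ‖ ^ k / R) ^ ((k : ℝ)⁻¹)) (by positivity)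
    (fun w hw => by
      have h1 : ContinuousAt (fun w : ℂ => (κ / w) ^ k) w :=
        (continuousAt_const.div continuousAt_id hw).pow k
      have h2 : ContinuousAt N w :=
        (Complex.continuous_re.continuousAt.comp h1).abs.add
          (Complex.continuous_im.continuousAt.comp h1).abs
      exact ((h2.mul (continuous_norm.continuousAt.pow k)).div_const R).rpow_const
        (Or.inr hk'.le))
    (fun w hw => by
      have := hlow w hw
      simp only [hm]; gcongr)
    (fun w hw => by
      have := hupp w hw
      have := hNnn w
      simp only [hm]; gcongr)
    (fun t ht w => by
      simp only [hm]
      congr 2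
      have h1 : (κ / (t * w)) ^ k = ((t⁻¹ ^ k : ℝ) : ℂ) * (κ / w) ^ k := by
        push_cast
        rw [← mul_pow]
        congr 1
        field_simp
      simp only [hN]
      rw [h1, Complex.re_ofReal_mul, Complex.im_ofReal_mul, abs_mul, abs_mul,
        abs_of_nonneg (a := t⁻¹ ^ k) (by positivity), norm_mul, Complex.norm_real,
        Real.norm_of_nonneg ht.le, mul_pow, inv_pow]
      field_simp)
  refine ⟨φ, hφ, hr.trans ?_, h0⟩
  ext w
  by_cases hw : w = 0
  · simp [hw]
  · have hw' := norm_pos_iff.2 hw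
    simp only [mem_ofPred_eq, hw, false_or, hm]
    rw [Real.lt_rpow_inv_iff_of_pos hw'.le (by have := hNnn w; positivity)
      (inv_pos.1 hk'), Real.rpow_natCast, lt_div_iff₀ hR, mul_comm,
      mul_lt_mul_iff_left₀ (by positivity)]

/-- A point recovers its petal: in `w = κ * invRoot k ((κ / w) ^ k)` the second factor sees only `κ
^ k`. -/
lemma planarPetal_disjoint {k : ℕ} (hk : k ≠ 0) {κ κ' : ℂ} (hκ : κ ≠ 0) (hpow : κ' ^ k = κ ^ k)
    {R : ℝ} (hR : 0 < R) (h : κ ≠ κ') : Disjoint (planarPetal k κ R) (planarPetal k κ' R) := by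
  have hκ' : κ' ≠ 0 := by
    rintro rfl
    rw [zero_pow hk] at hpow
    exact pow_ne_zero k hκ hpow.symm
  refine Set.disjoint_left.2 fun w hw hw' => h ?_
  have h1 := (planarPetal_spec hk hκ hR hw).2.2
  have h2 := (planarPetal_spec hk hκ' hR hw').2.2
  rw [div_pow, hpow, ← div_pow] at h2
  exact mul_right_cancel₀ (invRoot_ne_zero _ _) (h1.symm.trans h2)

lemma exists_mem_planarPetal {k : ℕ} (hk : k ≠ 0) {κ ζ : ℂ} (hκ : κ ≠ 0)
    (hζ : IsPrimitiveRoot ζ k) {R : ℝ} (hR : 0 < R) {w : ℂ} (hw : w ≠ 0)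
    (hV : (κ / w) ^ k ∈ coneComplement R) : ∃ j < k, w ∈ planarPetal k (κ * ζ ^ j) R := by
  have : NeZero k := ⟨hk⟩
  have h0 := Complex.slitPlane_ne_zero (mem_slitPlane_of_le hR hV.le)
  have hi := invRoot_ne_zero k ((κ / w) ^ k)
  obtain ⟨j, hj, hj'⟩ := hζ.eq_pow_of_pow_eq_one (ξ := w / (κ * invRoot k ((κ / w) ^ k))) (by
    rw [div_pow, mul_pow, invRoot_pow hk h0, div_pow]
    field_simp)
  refine ⟨j, hj, _, hV, ?_⟩
  simp only [hj']
  field_simp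

lemma planarPetal_rotate_spec {k : ℕ} {κ ζ : ℂ} (hζ : ζ ^ k = 1) (j : ℕ) (w : ℂ) :
    (κ * ζ ^ j / w) ^ k = (κ / w) ^ k := by
  rw [div_pow, mul_pow, ← pow_mul, mul_comm j, pow_mul, hζ, one_pow, mul_one, ← div_pow]

/-- The planar flower is the union of the origin and the `2k` petals. -/
lemma flower_eq_union {k : ℕ} (hk : k ≠ 0) {κ ζ η : ℂ} (hκ : κ ≠ 0)
    (hζ : IsPrimitiveRoot ζ k) (hη : η ^ k = -1) {R : ℝ} (hR : 0 < R) :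
    {w : ℂ | w = 0 ∨ R < |((κ / w) ^ k).re| + |((κ / w) ^ k).im|} =
      {0} ∪ (⋃ j : Fin k, planarPetal k (κ * ζ ^ (j : ℕ)) R) ∪
        ⋃ j : Fin k, planarPetal k (κ * η * ζ ^ (j : ℕ)) R := by
  have hη0 : η ≠ 0 := by
    rintro rfl
    simp [zero_pow hk] at hη
  have hζ0 : ζ ≠ 0 := hζ.ne_zero hk
  have hneg : ∀ w, (κ * η / w) ^ k = -(κ / w) ^ k := fun w => by
    rw [div_pow, mul_pow, hη, div_pow]; ring
  ext w
  simp only [mem_union, mem_singleton_iff, mem_iUnion, mem_ofPred_eq]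
  constructor
  · rintro (h | h)
    · exact Or.inl (Or.inl h)
    by_cases hw : w = 0
    · exact Or.inl (Or.inl hw)
    -- The exterior of the square `|Re| + |Im| ≤ R` is the cone complement together with its
    -- negative. The factor `η` exchanges `V` and `-V`.
    rcases le_total 0 ((κ / w) ^ k).re with hre | hre
    · rw [abs_of_nonneg hre] at h
      obtain ⟨j, hj, hj'⟩ := exists_mem_planarPetal hk hκ hζ hR hw h
      exact Or.inl (Or.inr ⟨⟨j, hj⟩, hj'⟩)
    · rw [abs_of_nonpos hre] at h
      obtain ⟨j, hj, hj'⟩ := exists_mem_planarPetal hk (mul_ne_zero hκ hη0) hζ hR hw (by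
        rw [hneg]; simpa [coneComplement] using h)
      exact Or.inr ⟨⟨j, hj⟩, hj'⟩
  · rintro ((h | ⟨j, h⟩) | ⟨j, h⟩)
    · exact Or.inl h
    · have h1 := (planarPetal_spec hk (mul_ne_zero hκ (pow_ne_zero _ hζ0)) hR h).2.1
      rw [planarPetal_rotate_spec hζ.pow_eq_one] at h1
      exact Or.inr (lt_of_lt_of_le h1 (by gcongr; exact le_abs_self _))
    · have h1 := (planarPetal_spec hk (mul_ne_zero (mul_ne_zero hκ hη0) (pow_ne_zero _ hζ0)) hR
        h).2.1
      rw [planarPetal_rotate_spec hζ.pow_eq_one, hneg] at h1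
      refine Or.inr (lt_of_lt_of_le h1 ?_)
      rw [Complex.neg_re, Complex.neg_im, abs_neg]
      gcongr
      exact neg_le_abs _

/-! ### Fibred coordinates close to the identity -/

/-- On the tube of radius `r`, the fibre maps of `h` fix the origin and differ from the identity
by a map with Lipschitz constant `1 / 2`. -/
structure IsNearIdentity (h : UnitAddCircle × ℂ → ℂ) (r : ℝ) : Prop where
  continuous : Continuous h
  map_zero : ∀ θ, h (θ, 0) = 0
  norm_sub_le : ∀ θ, ∀ z₁ z₂ : ℂ, ‖z₁‖ < r → ‖z₂‖ < r →
    ‖h (θ, z₁) - h (θ, z₂) - (z₁ - z₂)‖ ≤ 1 / 2 * ‖z₁ - z₂‖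

namespace IsNearIdentity

variable {h : UnitAddCircle × ℂ → ℂ} {r : ℝ}

lemma mono (hh : IsNearIdentity h r) {s : ℝ} (hs : s ≤ r) : IsNearIdentity h s :=
  ⟨hh.continuous, hh.map_zero, fun θ z₁ z₂ h₁ h₂ =>
    hh.norm_sub_le θ z₁ z₂ (h₁.trans_le hs) (h₂.trans_le hs)⟩

lemma dist_le (hh : IsNearIdentity h r) (θ : UnitAddCircle) {z₁ z₂ : ℂ} (h₁ : ‖z₁‖ < r)
    (h₂ : ‖z₂‖ < r) : ‖z₁ - z₂‖ ≤ 2 * ‖h (θ, z₁) - h (θ, z₂)‖ := by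
  have h3 := hh.norm_sub_le θ z₁ z₂ h₁ h₂
  have h4 := norm_sub_norm_le (z₁ - z₂) (h (θ, z₁) - h (θ, z₂))
  rw [norm_sub_rev (z₁ - z₂)] at h4
  linarith

lemma injective (hh : IsNearIdentity h r) (θ : UnitAddCircle) {z₁ z₂ : ℂ} (h₁ : ‖z₁‖ < r)
    (h₂ : ‖z₂‖ < r) (he : h (θ, z₁) = h (θ, z₂)) : z₁ = z₂ := by
  have := hh.dist_le θ h₁ h₂
  rw [he, sub_self, norm_zero, mul_zero] at this
  exact sub_eq_zero.1 (norm_le_zero_iff.1 this)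

lemma norm_le_two_mul (hh : IsNearIdentity h r) {p : UnitAddCircle × ℂ} (hp : p ∈ tube r) :
    ‖p.2‖ ≤ 2 * ‖h p‖ := by
  have hp' : ‖p.2‖ < r := hp
  have := hh.dist_le p.1 hp' (z₂ := 0) (by simpa using (norm_nonneg _).trans_lt hp')
  simpa [hh.map_zero] using this

lemma norm_apply_le (hh : IsNearIdentity h r) {p : UnitAddCircle × ℂ} (hp : p ∈ tube r) :
    ‖h p‖ ≤ 2 * ‖p.2‖ := by
  have hp' : ‖p.2‖ < r := hp
  have h1 := hh.norm_sub_le p.1 p.2 0 hp' (by simpa using (norm_nonneg _).trans_lt hp')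
  simp only [hh.map_zero, sub_zero] at h1
  have h2 := norm_sub_norm_le (h p) p.2
  have : ‖h p - p.2‖ ≤ 1 / 2 * ‖p.2‖ := h1
  linarith [norm_nonneg p.2]

lemma ne_zero (hh : IsNearIdentity h r) {p : UnitAddCircle × ℂ} (hp : p ∈ tube r)
    (hz : p ∉ zeroSection) : h p ≠ 0 := by
  intro h0
  have := hh.norm_le_two_mul hp
  rw [h0, norm_zero, mul_zero] at this
  exact hz (norm_le_zero_iff.1 this)

lemma apply_eq_zero (hh : IsNearIdentity h r) {p : UnitAddCircle × ℂ} (hz : p ∈ zeroSection) :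
    h p = 0 := by
  obtain ⟨θ, z⟩ := p
  obtain rfl : z = 0 := hz
  exact hh.map_zero θ

/-- The solution is the fixed point of `z ↦ z - h (θ, z) + w`, which contracts the closed ball of
radius `2 * ‖w‖` into itself. -/
lemma exists_preimage (hh : IsNearIdentity h r) (θ : UnitAddCircle) {w : ℂ} (hw : ‖w‖ < r / 2) :
    ∃ z, ‖z‖ < r ∧ h (θ, z) = w := by
  set s := 2 * ‖w‖ with hs
  have hsr : s < r := by rw [hs]; linarith
  set g : ℂ → ℂ := fun z => z - h (θ, z) + w with hg
  have hmaps : MapsTo g (Metric.closedBall 0 s) (Metric.closedBall 0 s) := by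
    intro z hz
    rw [mem_closedBall_zero_iff] at hz ⊢
    have h1 := hh.norm_sub_le θ z 0 (hz.trans_lt hsr)
      (by simpa using (norm_nonneg z).trans_lt (hz.trans_lt hsr))
    simp only [hh.map_zero, sub_zero] at h1
    rw [norm_sub_rev] at h1
    calc ‖g z‖ ≤ ‖z - h (θ, z)‖ + ‖w‖ := norm_add_le _ _
      _ ≤ 1 / 2 * s + ‖w‖ := by linarith
      _ = s := by rw [hs]; ring
  have hcontr : ContractingWith (1 / 2) (hmaps.restrict g _ _) := by
    refine ⟨by rw [← NNReal.coe_lt_coe]; norm_num, LipschitzWith.of_dist_le_mul ?_⟩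
    rintro ⟨x, hx⟩ ⟨y, hy⟩
    rw [mem_closedBall_zero_iff] at hx hy
    have h1 := hh.norm_sub_le θ x y (hx.trans_lt hsr) (hy.trans_lt hsr)
    rw [norm_sub_rev] at h1
    change dist (g x) (g y) ≤ _ * dist x y
    rw [dist_eq_norm, dist_eq_norm]
    have : g x - g y = x - y - (h (θ, x) - h (θ, y)) := by simp only [hg]; ring
    rw [this]
    simpa using h1
  obtain ⟨z, hz, hfix, -⟩ := hcontr.exists_fixedPoint' Metric.isClosed_closedBall.isComplete hmaps
    (x := 0) (by simp [hs]) (edist_ne_top _ _)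
  refine ⟨z, (mem_closedBall_zero_iff.1 hz).trans_lt hsr, ?_⟩
  have h2 : z - h (θ, z) + w = z := hfix
  linear_combination -h2

/-- The fibred map `(θ, z) ↦ (θ, h (θ, z))` as a homeomorphism onto the tube of radius `r / 2`. -/
lemma exists_openPartialHomeomorph (hh : IsNearIdentity h r) :
    ∃ e : OpenPartialHomeomorph (UnitAddCircle × ℂ) (UnitAddCircle × ℂ),
      (∀ p, e p = (p.1, h p)) ∧ e.target = tube (r / 2) ∧
        e.source = {p | p ∈ tube r ∧ h p ∈ Metric.ball 0 (r / 2)} := by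
  have hex : ∀ q : UnitAddCircle × ℂ, ∃ z, q ∈ tube (r / 2) → ‖z‖ < r ∧ h (q.1, z) = q.2 := by
    intro q
    by_cases hq : q ∈ tube (r / 2)
    · obtain ⟨z, hz⟩ := hh.exists_preimage q.1 hq
      exact ⟨z, fun _ => hz⟩
    · exact ⟨0, fun h => absurd h hq⟩
  choose g hg using hex
  have hopen : ∀ s, IsOpen (tube s) := fun s => isOpen_lt continuous_snd.norm continuous_const
  have hball : ∀ q ∈ tube (r / 2), q.2 ∈ Metric.ball (0 : ℂ) (r / 2) :=
    fun q hq => mem_ball_zero_iff.2 hq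
  refine ⟨{ toFun := fun p => (p.1, h p)
            invFun := fun q => (q.1, g q)
            source := {p | p ∈ tube r ∧ h p ∈ Metric.ball 0 (r / 2)}
            target := tube (r / 2)
            map_source' := fun p hp => mem_ball_zero_iff.1 hp.2
            map_target' := fun q hq => ⟨(hg q hq).1, by
              rw [(hg q hq).2]; exact hball q hq⟩
            left_inv' := fun p hp => by
              have hp' : (p.1, h p) ∈ tube (r / 2) := mem_ball_zero_iff.1 hp.2
              exact Prod.ext rfl (hh.injective p.1 (hg _ hp').1 hp.1 (hg _ hp').2)
            right_inv' := fun q hq => Prod.ext rfl (hg q hq).2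
            open_source := (hopen r).inter (Metric.isOpen_ball.preimage hh.continuous)
            open_target := hopen _
            continuousOn_toFun := (continuous_fst.prodMk hh.continuous).continuousOn
            continuousOn_invFun := ?_ }, fun _ => rfl, rfl, rfl⟩
  -- Over the base point of `q'`, compare `g q'` with the fixed `g q`: their distance is at most
  -- twice that of their images, which tends to zero by continuity of `h`.
  refine continuousOn_fst.prodMk fun q hq => ?_
  have hlim : Tendsto (fun q' : UnitAddCircle × ℂ => 2 * ‖q'.2 - h (q'.1, g q)‖)
      (𝓝[tube (r / 2)] q) (𝓝 0) := by
    have hc : Continuous fun q' : UnitAddCircle × ℂ => 2 * ‖q'.2 - h (q'.1, g q)‖ := by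
      have := hh.continuous
      fun_prop
    refine (hc.tendsto' q 0 ?_).mono_left nhdsWithin_le_nhds
    simp [(hg q hq).2]
  rw [ContinuousWithinAt, tendsto_iff_norm_sub_tendsto_zero]
  refine squeeze_zero' (Eventually.of_forall fun _ => norm_nonneg _) ?_ hlim
  filter_upwards [self_mem_nhdsWithin] with q' hq'
  have := hh.dist_le q'.1 (hg q' hq').1 (hg q hq).1
  rwa [(hg q' hq').2] at this

/-- A planar disc pulled back under the fibre maps of `h`. -/
lemma exists_trivialization (hh : IsNearIdentity h r) {φ : Metric.ball (0 : ℂ) 1 → ℂ}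
    (hφ : IsOpenEmbedding φ) (hr : range φ ⊆ Metric.ball 0 (r / 2)) :
    ∃ Φ, IsDiscTrivialization Φ {p | p ∈ tube r ∧ h p ∈ range φ} ∧
      ∀ q, Φ q ∈ tube r ∧ h (Φ q) = φ q.2 := by
  obtain ⟨e, he, het, hes⟩ := hh.exists_openPartialHomeomorph
  have hψ : IsOpenEmbedding (Prod.map id φ : UnitAddCircle × Metric.ball (0 : ℂ) 1 → _) :=
    IsOpenEmbedding.id.prodMap hφ
  have hmem : ∀ q : UnitAddCircle × Metric.ball (0 : ℂ) 1, Prod.map id φ q ∈ e.target := by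
    intro q
    rw [het]
    exact mem_ball_zero_iff.1 (hr (mem_range_self q.2))
  have : Nonempty (UnitAddCircle × Metric.ball (0 : ℂ) 1) :=
    ⟨(0, ⟨0, Metric.mem_ball_self one_pos⟩)⟩
  have hval : ∀ q, e (e.symm (Prod.map id φ q)) = (q.1, φ q.2) := fun q => e.right_inv (hmem q)
  have hsrc : ∀ q, e.symm (Prod.map id φ q) ∈ e.source := fun q => e.map_target (hmem q)
  refine ⟨fun q => e.symm (Prod.map id φ q), ⟨?_, ?_, fun q => ?_⟩, fun q => ⟨?_, ?_⟩⟩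
  · refine ((hψ.toOpenPartialHomeomorph _).trans e.symm).isOpenEmbedding ?_
    refine eq_univ_of_forall fun q => ?_
    simp only [OpenPartialHomeomorph.trans_source, mem_inter_iff, mem_preimage]
    exact ⟨by simp, hmem q⟩
  · ext p
    constructor
    · rintro ⟨q, rfl⟩
      have h1 := hsrc q
      have h2 := hval q
      rw [he] at h2
      rw [hes] at h1
      exact ⟨h1.1, q.2, (congrArg Prod.snd h2).symm⟩
    · rintro ⟨hp, u, hu⟩
      have hps : p ∈ e.source := by
        rw [hes]; exact ⟨hp, hr ⟨u, hu⟩⟩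
      refine ⟨(p.1, u), ?_⟩
      have : Prod.map id φ (p.1, u) = e p := by
        rw [he]; exact Prod.ext rfl hu
      simp only [this]
      exact e.left_inv hps
  · have h2 := hval q
    rw [he] at h2
    exact congrArg Prod.fst h2
  · have h1 := hsrc q
    rw [hes] at h1
    exact h1.1
  · have h2 := hval q
    rw [he] at h2
    exact congrArg Prod.snd h2

end IsNearIdentity

/-! ### From the normal form to the petals -/

/-- With `w' = w (1 + x)` and `x ≈ A w^k`, the expansion `(1 + x)^(-k) ≈ 1 - k x` gives `c / w'^k -
c / w^k ≈ -k A c = 1`. The linearization error and the error `C ‖w‖^(k+2)` each contribute at most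
`1/8`. -/
lemma planar_translation_estimate {k : ℕ} (hk : k ≠ 0) {A c : ℂ} (hA : k * A * c = -1) {C δ : ℝ}
    (hC : 0 ≤ C) (hδ : 0 < δ) : ∃ ρ > 0, ∀ w w' : ℂ, w ≠ 0 → ‖w‖ < ρ →
      ‖w' - w - A * w ^ (k + 1)‖ ≤ C * ‖w‖ ^ (k + 2) →
      w' ≠ 0 ∧ ‖w' - w‖ ≤ δ * ‖w‖ ∧ ‖c / w' ^ k - c / w ^ k - 1‖ ≤ 1 / 4 := by
  set B := ‖A‖ + C + 1 with hB
  have hB0 : 0 < B := by positivity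
  set η := 1 / (8 * (‖c‖ + 1) * B) with hη
  have hη0 : 0 < η := by positivity
  have hder : HasDerivAt (fun x : ℂ => ((1 + x) ^ k)⁻¹) (-k) 0 := by
    have h1 : HasDerivAt (fun x : ℂ => 1 + x) 1 0 := (hasDerivAt_id _).const_add 1
    exact ((h1.pow k).inv (by simp)).congr_deriv (by simp)
  have hlo := (hasDerivAt_iff_isLittleO.1 hder).def hη0
  obtain ⟨ε, hε, hball⟩ := Metric.eventually_nhds_iff_ball.1 hlo
  have hkC : 0 ≤ k * C := by positivity
  refine ⟨min 1 (min (min (ε / B) (min (δ / B) (1 / (2 * B)))) (1 / (8 * (‖c‖ + 1) * (k * C + 1)))),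
    by positivity, fun w w' hw hρ hww => ?_⟩
  simp only [lt_min_iff] at hρ
  obtain ⟨hw1, ⟨hwε, hwδ, hwB⟩, hwC⟩ := hρ
  have hwn := norm_pos_iff.2 hw
  set x := w' / w - 1 with hx
  have hw' : w' = w * (1 + x) := by rw [hx]; field_simp; ring
  have hwk : ‖w‖ ^ k ≤ ‖w‖ := pow_le_of_le_one hwn.le hw1.le hk
  have hxA : ‖x - A * w ^ k‖ ≤ C * ‖w‖ ^ (k + 1) := by
    have e : w' - w - A * w ^ (k + 1) = w * (x - A * w ^ k) := by rw [hw']; ring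
    rw [e, norm_mul] at hww
    refine le_of_mul_le_mul_left (hww.trans_eq ?_) hwn
    ring
  have hxB : ‖x‖ ≤ B * ‖w‖ ^ k := by
    calc ‖x‖ = ‖(x - A * w ^ k) + A * w ^ k‖ := by ring_nf
      _ ≤ C * ‖w‖ ^ (k + 1) + ‖A‖ * ‖w‖ ^ k := by
        refine (norm_add_le _ _).trans ?_
        rw [norm_mul, norm_pow]
        gcongr
      _ ≤ C * ‖w‖ ^ k + ‖A‖ * ‖w‖ ^ k := by
        gcongr ?_ + _
        exact mul_le_mul_of_nonneg_left (pow_le_pow_of_le_one hwn.le hw1.le (Nat.le_succ k)) hC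
      _ ≤ B * ‖w‖ ^ k := by rw [hB]; nlinarith [pow_pos hwn k]
  have hxw : ‖x‖ ≤ B * ‖w‖ := hxB.trans (by gcongr)
  have hlt : ∀ t, ‖w‖ < t / B → ‖x‖ < t := fun t ht => by
    rw [lt_div_iff₀ hB0] at ht
    linarith
  have hx2 : ‖x‖ < 1 / 2 := hlt _ (by rwa [div_div])
  have h1x : 1 + x ≠ 0 := by
    intro h
    have : x = -1 := by linear_combination h
    rw [this] at hx2
    norm_num at hx2
  refine ⟨hw' ▸ mul_ne_zero hw h1x, ?_, ?_⟩
  · have e : w' - w = x * w := by rw [hw']; ring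
    rw [e, norm_mul]
    exact mul_le_mul_of_nonneg_right (hlt δ hwδ).le hwn.le
  · have h2 := hball x (by rw [mem_ball_zero_iff]; exact hlt ε hwε)
    simp only [sub_zero, add_zero, one_pow, inv_one, smul_eq_mul] at h2
    have hwk0 : w ^ k ≠ 0 := pow_ne_zero k hw
    have hxk0 : (1 + x) ^ k ≠ 0 := pow_ne_zero k h1x
    have e : c / w' ^ k - c / w ^ k - 1 =
        c / w ^ k * ((((1 + x) ^ k)⁻¹ - 1 - x * -k) - k * (x - A * w ^ k)) := by
      have : (1 : ℂ) = -(k * A * c) := by rw [hA]; ring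
      rw [hw', mul_pow]
      field_simp
      linear_combination (-(w ^ k * (1 + x) ^ k)) * this
    rw [e, norm_mul, norm_div, norm_pow]
    have h3 : ‖(((1 + x) ^ k)⁻¹ - 1 - x * -k) - k * (x - A * w ^ k)‖ ≤
        (η * B + k * C * ‖w‖) * ‖w‖ ^ k := by
      refine (norm_sub_le _ _).trans ?_
      rw [norm_mul, Complex.norm_natCast]
      calc _ ≤ η * (B * ‖w‖ ^ k) + k * (C * ‖w‖ ^ (k + 1)) := by
            gcongr
            exact h2.trans (by gcongr)
        _ = _ := by ring
    have h4 : ‖c‖ * (η * B) ≤ 1 / 8 := by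
      rw [hη]
      have : ‖c‖ * (1 / (8 * (‖c‖ + 1) * B) * B) = ‖c‖ / (‖c‖ + 1) / 8 := by
        field_simp
      rw [this]
      have : ‖c‖ / (‖c‖ + 1) ≤ 1 := by
        rw [div_le_one (by positivity)]; linarith
      linarith
    have h5 : ‖c‖ * (k * C * ‖w‖) ≤ 1 / 8 := by
      have h6 : ‖c‖ * (k * C) ≤ (‖c‖ + 1) * (k * C + 1) := by
        have := norm_nonneg c
        gcongr <;> linarith
      rw [lt_div_iff₀ (by positivity)] at hwC
      nlinarith
    calc _ ≤ ‖c‖ / ‖w‖ ^ k * ((η * B + k * C * ‖w‖) * ‖w‖ ^ k) := by gcongr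
      _ = ‖c‖ * (η * B) + ‖c‖ * (k * C * ‖w‖) := by
        have := pow_pos hwn k
        field_simp
      _ ≤ 1 / 4 := by linarith

/-- The part of the tube of radius `r` which `h` maps to a planar petal is an attracting petal of
any map that is close, in the coordinate `(κ / h) ^ k`, to the translation by `1`. -/
lemma isAttractingPetal_of_translation {h : UnitAddCircle × ℂ → ℂ} {r : ℝ}
    (hh : IsNearIdentity h r) {k : ℕ} (hk : k ≠ 0) {κ : ℂ} (hκ : κ ≠ 0) {δ R ρ : ℝ} (hR : 0 < R)
    (hstep : ∀ w w' : ℂ, w ∈ closure (planarPetal k κ R) → w ≠ 0 → w' ≠ 0 → ‖w' - w‖ ≤ δ * ‖w‖ →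
      ‖(κ / w') ^ k - (κ / w) ^ k - 1‖ ≤ 1 / 4 → w' ∈ planarPetal k κ R)
    (hρ : 0 < ρ) (hρr : ρ ≤ r) (hRρ : 2 * (‖κ‖ / (ρ / 4)) ^ k ≤ R)
    {G : UnitAddCircle × ℂ → UnitAddCircle × ℂ} (hGz : MapsTo G zeroSection zeroSection)
    (hG : ∀ p ∈ tube ρ, p ∉ zeroSection → G p ∈ tube r ∧ h (G p) ≠ 0 ∧
      ‖h (G p) - h p‖ ≤ δ * ‖h p‖ ∧ ‖(κ / h (G p)) ^ k - (κ / h p) ^ k - 1‖ ≤ 1 / 4) :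
    IsAttractingPetal G {p | p ∈ tube r ∧ h p ∈ planarPetal k κ R} ∧
      closure {p | p ∈ tube r ∧ h p ∈ planarPetal k κ R} ⊆ tube ρ := by
  set P : Set (UnitAddCircle × ℂ) := {p | p ∈ tube r ∧ h p ∈ planarPetal k κ R} with hP
  have hsub : planarPetal k κ R ⊆ Metric.ball 0 (ρ / 4) :=
    planarPetal_norm_lt hk hκ (by positivity) hRρ
  have hcl : closure P ⊆ {p | ‖p.2‖ ≤ ρ / 2} := by
    refine closure_minimal (fun p hp => ?_) (isClosed_le continuous_snd.norm continuous_const)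
    have h1 := hh.norm_le_two_mul hp.1
    have h2 := mem_ball_zero_iff.1 (hsub hp.2)
    change ‖p.2‖ ≤ ρ / 2
    linarith
  have hclt : closure P ⊆ tube ρ := fun p hp => by
    have h1 : ‖p.2‖ ≤ ρ / 2 := hcl hp
    change ‖p.2‖ < ρ
    linarith
  have htr : tube ρ ⊆ tube r := fun p (hp : ‖p.2‖ < ρ) => lt_of_lt_of_le hp hρr
  have hPz : ∀ p ∈ P, p ∉ zeroSection := fun p hp hz =>
    (planarPetal_spec hk hκ hR hp.2).1 (hh.apply_eq_zero hz)
  obtain ⟨φ, hφ, hφr⟩ := exists_planarPetal_embedding hk hκ hR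
  have htube : IsDiscTube P := by
    obtain ⟨Φ, hΦ, -⟩ := hh.exists_trivialization hφ
      (by rw [hφr]; exact hsub.trans (Metric.ball_subset_ball (by linarith)))
    rw [hφr] at hΦ
    exact ⟨Φ, hΦ⟩
  have hmaps : ∀ p ∈ closure P, p ∉ zeroSection → G p ∈ P := by
    intro p hp hz
    obtain ⟨h1, h2, h3, h4⟩ := hG p (hclt hp) hz
    refine ⟨h1, hstep (h p) _ ?_ (hh.ne_zero (htr (hclt hp)) hz) h2 h3 h4⟩
    exact closure_mono (image_subset_iff.2 fun p hp => hp.2)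
      (image_closure_subset_closure_image hh.continuous (mem_image_of_mem h hp))
  have hmapsP : MapsTo G P P := fun p hp => hmaps p (subset_closure hp) (hPz p hp)
  refine ⟨⟨htube, fun θ => ?_, fun p hp => ?_, fun ε hε => ?_⟩, hclt⟩
  · rw [(isOpen_fibre htube.isOpen θ).frontier_eq]
    refine ⟨?_, fun h0 => hPz (θ, 0) h0 rfl⟩
    rw [Metric.mem_closure_iff]
    intro ε hε
    obtain ⟨w, hw, hwε⟩ := Metric.mem_closure_iff.1
      (zero_mem_closure_planarPetal hk hκ (R := R)) (ε / 2) (by positivity)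
    have hwr := mem_ball_zero_iff.1 (hsub hw)
    obtain ⟨z, hz, hzw⟩ := hh.exists_preimage θ (w := w) (by linarith)
    refine ⟨z, ⟨hz, show h (θ, z) ∈ _ by rwa [hzw]⟩, ?_⟩
    have h1 := hh.norm_le_two_mul (p := (θ, z)) hz
    rw [hzw] at h1
    rw [dist_zero_left] at hwε ⊢
    change ‖z‖ ≤ _ at h1
    linarith
  · by_cases hz : p ∈ zeroSection
    · exact Or.inr (hGz hz)
    · exact Or.inl (hmaps p hp hz)
  · have hgrow : ∀ n : ℕ, ∀ p ∈ P, R + n / 2 <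
        ((κ / h (G^[n] p)) ^ k).re + |((κ / h (G^[n] p)) ^ k).im| := by
      intro n p hp
      induction n with
      | zero =>
        have : R < _ := (planarPetal_spec hk hκ hR hp.2).2.1
        simpa using this
      | succ n ih =>
        have hq : G^[n] p ∈ P := hmapsP.iterate n hp
        obtain ⟨-, -, -, h4⟩ := hG _ (hclt (subset_closure hq)) (hPz _ hq)
        rw [Function.iterate_succ_apply']
        have hre := (abs_le.1 ((Complex.abs_re_le_norm _).trans h4)).1
        have him := (Complex.abs_im_le_norm _).trans h4
        simp only [Complex.sub_re, Complex.one_re, Complex.sub_im, Complex.one_im,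
          sub_zero] at hre him
        have := abs_sub_abs_le_abs_sub ((κ / h (G^[n] p)) ^ k).im ((κ / h (G (G^[n] p))) ^ k).im
        rw [abs_sub_comm] at this
        push_cast
        linarith
    obtain ⟨N, hN⟩ := exists_nat_gt (4 * (‖κ‖ / (ε / 2)) ^ k)
    refine eventually_atTop.2 ⟨N, fun n hn p hp => ?_⟩
    have hq : G^[n] p ∈ P := hmapsP.iterate n hp
    have h1 := hgrow n p hp
    have h2 := le_two_mul_norm ((κ / h (G^[n] p)) ^ k)
    have h3 := hh.ne_zero hq.1 (hPz _ hq)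
    rw [norm_pow, norm_div] at h2
    have hn' : (N : ℝ) ≤ n := by exact_mod_cast hn
    have h4 : (‖κ‖ / (ε / 2)) ^ k < (‖κ‖ / ‖h (G^[n] p)‖) ^ k := by linarith
    have h5 := lt_of_pow_lt_pow_left₀ k (by positivity) h4
    rw [div_lt_div_iff_of_pos_left (norm_pos_iff.2 hκ) (by positivity) (norm_pos_iff.2 h3)] at h5
    have h6 := hh.norm_le_two_mul hq.1
    change ‖_‖ < ε
    linarith

/-- A fibred map that is conjugate, up to order `k + 2`, to `(θ, z) ↦ (θ + α, z + A z ^ (k + 1))`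
presents a `k`-petal parabolic behaviour. -/
theorem hasPetals_of_conjugate {f h : UnitAddCircle × ℂ → ℂ} {r : ℝ} (hr : 0 < r)
    (hf : IsNearIdentity f r) (hh : IsNearIdentity h r) {k : ℕ} (hk : k ≠ 0) {A : ℂ} (hA : A ≠ 0)
    {C : ℝ} (hC : 0 ≤ C) (α : UnitAddCircle)
    (hconj : ∀ p ∈ tube r,
      ‖h (p.1 + α, f p) - h p - A * h p ^ (k + 1)‖ ≤ C * ‖h p‖ ^ (k + 2)) :
    HasPetals (fun p => (p.1 + α, f p)) k := by
  set F : UnitAddCircle × ℂ → UnitAddCircle × ℂ := fun p => (p.1 + α, f p) with hF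
  have hkC : (k : ℂ) ≠ 0 := by exact_mod_cast hk
  obtain ⟨κ, hκk⟩ := IsAlgClosed.exists_pow_nat_eq (-1 / (k * A)) (Nat.pos_of_ne_zero hk)
  obtain ⟨η, hη⟩ := IsAlgClosed.exists_pow_nat_eq (-1 : ℂ) (Nat.pos_of_ne_zero hk)
  have hζ := Complex.isPrimitiveRoot_exp k hk
  set ζ := Complex.exp (2 * Real.pi * Complex.I / k)
  have hκ : κ ≠ 0 := by
    rintro rfl
    rw [zero_pow hk] at hκk
    exact div_ne_zero (neg_ne_zero.2 one_ne_zero) (mul_ne_zero hkC hA) hκk.symm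
  have hη0 : η ≠ 0 := by
    rintro rfl
    simp [zero_pow hk] at hη
  have hζ0 : ζ ≠ 0 := hζ.ne_zero hk
  have hkA : k * A * κ ^ k = -1 := by rw [hκk]; field_simp
  obtain ⟨δ, hδ, R₀, hR₀, hstep⟩ := exists_petal_step hk
  -- The `1 / 2` gives `‖h p‖ ≤ 2 * ‖h (F p)‖`; the `δ / 2` then becomes `δ` when the displacement
  -- is measured from `F p`, as the inverse map requires.
  obtain ⟨ρ₁, hρ₁, hest⟩ := planar_translation_estimate hk hkA hC
    (δ := min (δ / 2) (1 / 2)) (by positivity)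
  -- Preimages of the tube of radius `ρ` have norm below `2 * ρ`, and `h` at most doubles norms,
  -- hence the quarters.
  set ρ := min (r / 4) (ρ₁ / 4) with hρ
  have hρ0 : 0 < ρ := by positivity
  have hρr : ρ ≤ r / 4 := min_le_left _ _
  have hρρ : ρ ≤ ρ₁ / 4 := min_le_right _ _
  have hmove : ∀ p ∈ tube r, ‖p.2‖ < 2 * ρ → p ∉ zeroSection → h (F p) ≠ 0 ∧
      ‖h (F p) - h p‖ ≤ min (δ / 2) (1 / 2) * ‖h p‖ ∧
      ‖(κ / h (F p)) ^ k - (κ / h p) ^ k - 1‖ ≤ 1 / 4 := by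
    intro p hp hpρ hz
    have h1 := hh.norm_apply_le hp
    simpa only [div_pow] using hest (h p) (h (F p)) (hh.ne_zero hp hz) (by linarith) (hconj p hp)
  have hinj : InjOn F (tube r) := by
    intro p hp q hq hpq
    have h1 : p.1 = q.1 := add_right_cancel (congrArg Prod.fst hpq)
    have h2 : f (p.1, p.2) = f (p.1, q.2) :=
      (congrArg Prod.snd hpq : f p = f q).trans (by rw [h1])
    exact Prod.ext h1 (hf.injective p.1 hp hq h2)
  have hinv : ∀ q ∈ tube ρ, ∃ p ∈ tube r, F p = q ∧ ‖p.2‖ ≤ 2 * ‖q.2‖ := by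
    intro q (hq : ‖q.2‖ < ρ)
    obtain ⟨z, hz, hzq⟩ := hf.exists_preimage (q.1 - α) (w := q.2) (by linarith)
    refine ⟨(q.1 - α, z), hz, Prod.ext (sub_add_cancel _ _) hzq, ?_⟩
    have := hf.norm_le_two_mul (p := (q.1 - α, z)) hz
    rwa [hzq] at this
  have hFz : MapsTo F zeroSection zeroSection := fun p hp => hf.apply_eq_zero hp
  have hIz : MapsTo (localInverse F r) zeroSection zeroSection := by
    intro q (hq : q.2 = 0)
    obtain ⟨p, hp, rfl, hpq⟩ := hinv q (by simpa [tube, hq] using hρ0)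
    rw [localInverse_apply hinj hp]
    rw [hq, norm_zero, mul_zero] at hpq
    exact norm_le_zero_iff.1 hpq
  set R := max R₀ (2 * (‖κ‖ / (ρ / 4)) ^ k) with hR
  have hR0 : 0 < R := lt_of_lt_of_le hR₀ (le_max_left _ _)
  have hnorm : ∀ κ' : ℂ, ‖κ' ^ k‖ = ‖κ ^ k‖ → 2 * (‖κ'‖ / (ρ / 4)) ^ k ≤ R := fun κ' h => by
    rw [norm_pow, norm_pow] at h
    rw [div_pow, h, ← div_pow]
    exact le_max_right _ _
  have hζpow : ∀ (κ' : ℂ) (j : ℕ), (κ' * ζ ^ j) ^ k = κ' ^ k := fun κ' j => by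
    rw [mul_pow, ← pow_mul, mul_comm j, pow_mul, hζ.pow_eq_one, one_pow, mul_one]
  have hdisj : ∀ κ' : ℂ, κ' ≠ 0 → ∀ i j : Fin k, i ≠ j →
      Disjoint (planarPetal k (κ' * ζ ^ (i : ℕ)) R) (planarPetal k (κ' * ζ ^ (j : ℕ)) R) := by
    intro κ' hκ' i j hij
    refine planarPetal_disjoint hk (mul_ne_zero hκ' (pow_ne_zero _ hζ0)) ?_ hR0 fun he => ?_
    · rw [hζpow, hζpow]
    · exact hij (Fin.ext (hζ.pow_inj i.2 j.2 (mul_left_cancel₀ hκ' he)))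
  have hP := fun j : Fin k => isAttractingPetal_of_translation hh hk
    (mul_ne_zero hκ (pow_ne_zero j hζ0)) hR0
    (fun w w' => hstep R (le_max_left _ _) _ w w' (mul_ne_zero hκ (pow_ne_zero j hζ0)))
    hρ0 (by linarith) (hnorm _ (by rw [hζpow])) hFz (fun p (hp : ‖p.2‖ < ρ) hz => by
      have hpr : p ∈ tube r := by change ‖p.2‖ < r; linarith
      obtain ⟨h1, h2, h3⟩ := hmove p hpr (by linarith) hz
      refine ⟨?_, h1, h2.trans ?_, ?_⟩
      · have := hf.norm_apply_le hpr
        change ‖f p‖ < r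
        linarith
      · gcongr
        exact (min_le_left _ _).trans (by linarith)
      · rwa [planarPetal_rotate_spec hζ.pow_eq_one, planarPetal_rotate_spec hζ.pow_eq_one])
  -- Replacing `κ` by `κ * η` turns `V` into `-V`, in which the inverse of `V ↦ V + 1` is again the
  -- translation by `1`.
  have hQ := fun j : Fin k => isAttractingPetal_of_translation hh hk
    (mul_ne_zero (mul_ne_zero hκ hη0) (pow_ne_zero j hζ0)) hR0
    (fun w w' => hstep R (le_max_left _ _) _ w w'
      (mul_ne_zero (mul_ne_zero hκ hη0) (pow_ne_zero j hζ0)))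
    hρ0 (by linarith) (hnorm _ (by rw [hζpow, mul_pow, hη]; simp)) hIz
    (fun q (hq : ‖q.2‖ < ρ) hz => by
      obtain ⟨p, hp, rfl, hpq⟩ := hinv q hq
      rw [localInverse_apply hinj hp]
      have hpz : p ∉ zeroSection := fun h => hz (hFz h)
      obtain ⟨-, h2, h3⟩ := hmove p hp (by linarith) hpz
      refine ⟨hp, hh.ne_zero hp hpz, ?_, ?_⟩
      · have h4 := h2.trans (mul_le_mul_of_nonneg_right (min_le_right _ _) (norm_nonneg _))
        have h5 := h2.trans (mul_le_mul_of_nonneg_right (min_le_left _ _) (norm_nonneg _))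
        have h6 := norm_sub_norm_le (h p) (h (F p))
        rw [norm_sub_rev] at h6 ⊢
        have h7 : ‖h p‖ ≤ 2 * ‖h (F p)‖ := by linarith
        calc _ ≤ δ / 2 * ‖h p‖ := h5
          _ ≤ δ / 2 * (2 * ‖h (F p)‖) := by gcongr
          _ = _ := by ring
      · have hneg : ∀ w, (κ * η / w) ^ k = -(κ / w) ^ k := fun w => by
          rw [div_pow, mul_pow, hη, div_pow]; ring
        rw [planarPetal_rotate_spec hζ.pow_eq_one, planarPetal_rotate_spec hζ.pow_eq_one, hneg,
          hneg]
        have e : -(κ / h p) ^ k - -(κ / h (F p)) ^ k - 1 =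
            (κ / h (F p)) ^ k - (κ / h p) ^ k - 1 := by ring
        rwa [e])
  have htr : tube ρ ⊆ tube r := fun p (hp : ‖p.2‖ < ρ) => by
    change ‖p.2‖ < r; linarith
  refine ⟨r, hr, hinj, fun j => {p | p ∈ tube r ∧ h p ∈ planarPetal k (κ * ζ ^ (j : ℕ)) R},
    fun j => {p | p ∈ tube r ∧ h p ∈ planarPetal k (κ * η * ζ ^ (j : ℕ)) R},
    fun j => ⟨(hP j).2.trans htr, (hP j).1⟩, fun j => ⟨fun q hq => ⟨htr ((hQ j).2 hq), ?_⟩,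
    (hQ j).1⟩, fun i j hij => ?_, fun i j hij => ?_, ?_⟩
  · obtain ⟨p, hp, hpq, -⟩ := hinv q ((hQ j).2 hq)
    exact ⟨p, hp, hpq⟩
  · exact Set.disjoint_left.2 fun p hp hp' =>
      Set.disjoint_left.1 (hdisj κ hκ i j hij) hp.2 hp'.2
  · exact Set.disjoint_left.2 fun p hp hp' =>
      Set.disjoint_left.1 (hdisj _ (mul_ne_zero hκ hη0) i j hij) hp.2 hp'.2
  · obtain ⟨φ, hφ, hφr, hφ0⟩ := exists_flower_embedding hk hκ hR0
    rw [flower_eq_union hk hκ hζ hη hR0] at hφr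
    have hball : ∀ κ' : ℂ, κ' ≠ 0 → ‖κ' ^ k‖ = ‖κ ^ k‖ →
        planarPetal k κ' R ⊆ Metric.ball 0 (r / 2) := fun κ' h0 h1 =>
      (planarPetal_norm_lt hk h0 (by positivity) (hnorm κ' h1)).trans
        (Metric.ball_subset_ball (by linarith))
    obtain ⟨Φ, hΦ, hΦv⟩ := hh.exists_trivialization hφ (by
      rw [hφr]
      refine union_subset (union_subset ?_ (iUnion_subset fun j => hball _
        (mul_ne_zero hκ (pow_ne_zero _ hζ0)) (by rw [hζpow]))) (iUnion_subset fun j => hball _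
        (mul_ne_zero (mul_ne_zero hκ hη0) (pow_ne_zero _ hζ0))
        (by rw [hζpow, mul_pow, hη]; simp))
      simpa using hr)
    refine ⟨Φ, ?_, fun θ => Prod.ext (hΦ.2.2 _) ?_⟩
    · convert hΦ using 1
      rw [hφr]
      ext p
      simp only [mem_union, mem_iUnion, mem_ofPred_eq, mem_singleton_iff]
      constructor
      · rintro ((hz | ⟨j, hp, hj⟩) | ⟨j, hp, hj⟩)
        · have hz' : p.2 = 0 := hz
          exact ⟨by simpa [tube, hz'] using hr, Or.inl (Or.inl (hh.apply_eq_zero hz))⟩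
        · exact ⟨hp, Or.inl (Or.inr ⟨j, hj⟩)⟩
        · exact ⟨hp, Or.inr ⟨j, hj⟩⟩
      · rintro ⟨hp, (h0 | ⟨j, hj⟩) | ⟨j, hj⟩⟩
        · exact Or.inl (Or.inl (by_contra fun hz => hh.ne_zero hp hz h0))
        · exact Or.inl (Or.inr ⟨j, hp, hj⟩)
        · exact Or.inr ⟨j, hp, hj⟩
    · obtain ⟨h1, h2⟩ := hΦv (θ, ⟨0, Metric.mem_ball_self one_pos⟩)
      by_contra hz
      exact hh.ne_zero h1 hz (h2.trans hφ0)

/-! ### Fibred polynomials as maps and as coordinate changes -/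

/-- The second component of a fibred polynomial. -/
noncomputable def fibreMap (a₂ a₃ a₄ a₅ : C(UnitAddCircle, ℂ)) (p : UnitAddCircle × ℂ) : ℂ :=
  p.2 + a₂ p.1 * p.2 ^ 2 + a₃ p.1 * p.2 ^ 3 + a₄ p.1 * p.2 ^ 4 + a₅ p.1 * p.2 ^ 5

lemma continuous_fibreMap (a₂ a₃ a₄ a₅ : C(UnitAddCircle, ℂ)) :
    Continuous (fibreMap a₂ a₃ a₄ a₅) := by
  unfold fibreMap
  fun_prop

lemma norm_pow_sub_pow_le_of_le {r : ℝ} {z₁ z₂ : ℂ} (h₁ : ‖z₁‖ ≤ r) (h₂ : ‖z₂‖ ≤ r) (n : ℕ) :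
    ‖z₁ ^ (n + 1) - z₂ ^ (n + 1)‖ ≤ (n + 1) * r ^ n * ‖z₁ - z₂‖ := by
  have hr : 0 ≤ r := (norm_nonneg _).trans h₁
  induction n with
  | zero => simp
  | succ n ih =>
    have e : z₁ ^ (n + 2) - z₂ ^ (n + 2) =
        z₁ * (z₁ ^ (n + 1) - z₂ ^ (n + 1)) + (z₁ - z₂) * z₂ ^ (n + 1) := by ring
    rw [e]
    refine (norm_add_le _ _).trans ?_
    rw [norm_mul, norm_mul, norm_pow]
    calc _ ≤ r * ((n + 1) * r ^ n * ‖z₁ - z₂‖) + ‖z₁ - z₂‖ * r ^ (n + 1) := by gcongr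
      _ = _ := by push_cast; ring

lemma exists_isNearIdentity (a₂ a₃ a₄ a₅ : C(UnitAddCircle, ℂ)) :
    ∃ r > 0, IsNearIdentity (fibreMap a₂ a₃ a₄ a₅) r := by
  set M := ‖a₂‖ + ‖a₃‖ + ‖a₄‖ + ‖a₅‖ + 1 with hM
  have n₂ := norm_nonneg a₂
  have n₃ := norm_nonneg a₃
  have n₄ := norm_nonneg a₄
  have n₅ := norm_nonneg a₅
  have hM0 : 0 < M := by positivity
  -- Degrees 2 to 5 contribute Lipschitz constants summing to `(2 + 3 + 4 + 5) / 28 = 1 / 2`.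
  set r := min 1 (1 / (28 * M)) with hr
  have hr0 : 0 < r := by positivity
  have hr1 : r ≤ 1 := min_le_left _ _
  have hrM : M * r ≤ 1 / 28 := by
    have : r ≤ 1 / (28 * M) := min_le_right _ _
    rw [le_div_iff₀ (by positivity)] at this
    linarith
  refine ⟨r, hr0, continuous_fibreMap _ _ _ _, fun θ => by simp [fibreMap], ?_⟩
  intro θ z₁ z₂ h₁ h₂
  have key : ∀ (a : C(UnitAddCircle, ℂ)) (n : ℕ), n ≠ 0 → ‖a‖ ≤ M →
      ‖a θ * (z₁ ^ (n + 1) - z₂ ^ (n + 1))‖ ≤ (n + 1) * (1 / 28) * ‖z₁ - z₂‖ := by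
    intro a n hn ha
    have h3 := norm_pow_sub_pow_le_of_le h₁.le h₂.le n
    have h4 : r ^ n ≤ r := pow_le_of_le_one hr0.le hr1 hn
    rw [norm_mul]
    calc _ ≤ M * ((n + 1) * r ^ n * ‖z₁ - z₂‖) := by
          gcongr
          exact (a.norm_coe_le_norm θ).trans ha
      _ ≤ M * ((n + 1) * r * ‖z₁ - z₂‖) := by gcongr
      _ = (n + 1) * (M * r) * ‖z₁ - z₂‖ := by ring
      _ ≤ _ := by gcongr
  have e : fibreMap a₂ a₃ a₄ a₅ (θ, z₁) - fibreMap a₂ a₃ a₄ a₅ (θ, z₂) - (z₁ - z₂) =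
      a₂ θ * (z₁ ^ (1 + 1) - z₂ ^ (1 + 1)) + a₃ θ * (z₁ ^ (2 + 1) - z₂ ^ (2 + 1)) +
        a₄ θ * (z₁ ^ (3 + 1) - z₂ ^ (3 + 1)) + a₅ θ * (z₁ ^ (4 + 1) - z₂ ^ (4 + 1)) := by
    simp only [fibreMap]; ring
  rw [e]
  have k₂ := key a₂ 1 (by norm_num) (by linarith)
  have k₃ := key a₃ 2 (by norm_num) (by linarith)
  have k₄ := key a₄ 3 (by norm_num) (by linarith)
  have k₅ := key a₅ 4 (by norm_num) (by linarith)
  refine (norm_add_le _ _).trans ((add_le_add_left norm_add₃_le _).trans ?_)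
  push_cast at k₂ k₃ k₄ k₅
  linarith

lemma fibredPolynomial_eq (a₂ a₃ a₄ a₅ : C(UnitAddCircle, ℂ)) (α : ℝ) :
    fibredPolynomial a₂ a₃ a₄ a₅ α =
      fun p => (p.1 + (α : UnitAddCircle), fibreMap a₂ a₃ a₄ a₅ p) := rfl

/-- The number of petals of a fibred polynomial is unique. -/
lemma hasPetals_iff_of_hasPetals {a₂ a₃ a₄ a₅ : C(UnitAddCircle, ℂ)} {α : ℝ} {k : ℕ}
    (h : HasPetals (fibredPolynomial a₂ a₃ a₄ a₅ α) k) (l : ℕ) :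
    HasPetals (fibredPolynomial a₂ a₃ a₄ a₅ α) l ↔ l = k := by
  have hc : Continuous (fibredPolynomial a₂ a₃ a₄ a₅ α) := by
    have := continuous_fibreMap a₂ a₃ a₄ a₅
    rw [fibredPolynomial_eq]
    fun_prop
  have h0 : FixesZeroSection (fibredPolynomial a₂ a₃ a₄ a₅ α) := fun p => by
    simp [fibredPolynomial]
  exact ⟨fun hl => le_antisymm (hl.le hc h0 h) (h.le hc h0 hl), fun hl => hl ▸ h⟩

/-- Reduces the conjugacy to an algebraic identity: `E` is bounded on a compact tube, and `‖z‖ ≤ 2 *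
‖h‖` turns powers of `z` into powers of the new coordinate, at the price of `2 ^ (k + 2)`. -/
lemma hasPetals_of_remainder {a₂ a₃ a₄ a₅ b₂ b₃ b₄ b₅ : C(UnitAddCircle, ℂ)} {α : ℝ} {k : ℕ}
    (hk : k ≠ 0) {A : ℂ} (hA : A ≠ 0) {E : UnitAddCircle × ℂ → ℂ} (hE : Continuous E)
    (hconj : ∀ p, fibreMap b₂ b₃ b₄ b₅ (p.1 + (α : UnitAddCircle), fibreMap a₂ a₃ a₄ a₅ p) -
      fibreMap b₂ b₃ b₄ b₅ p - A * fibreMap b₂ b₃ b₄ b₅ p ^ (k + 1) = p.2 ^ (k + 2) * E p) :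
    HasPetals (fibredPolynomial a₂ a₃ a₄ a₅ α) k := by
  obtain ⟨r₁, hr₁, hf⟩ := exists_isNearIdentity a₂ a₃ a₄ a₅
  obtain ⟨r₂, hr₂, hh⟩ := exists_isNearIdentity b₂ b₃ b₄ b₅
  have hr : 0 < min r₁ r₂ := lt_min hr₁ hr₂
  have hcomp : IsCompact ((univ : Set UnitAddCircle) ×ˢ Metric.closedBall (0 : ℂ) (min r₁ r₂)) :=
    isCompact_univ.prod (isCompact_closedBall _ _)
  obtain ⟨C, hC⟩ := hcomp.exists_bound_of_continuousOn hE.continuousOn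
  rw [fibredPolynomial_eq]
  refine hasPetals_of_conjugate hr (hf.mono (min_le_left _ _)) (hh.mono (min_le_right _ _)) hk hA
    (C := 2 ^ (k + 2) * |C|) (by positivity) _ fun p hp => ?_
  have hb : ‖E p‖ ≤ |C| := (hC p ⟨mem_univ _, mem_closedBall_zero_iff.2 (le_of_lt hp)⟩).trans
    (le_abs_self C)
  have hz := (hh.mono (min_le_right r₁ r₂)).norm_le_two_mul hp
  rw [hconj p, norm_mul, norm_pow]
  calc _ ≤ (2 * ‖fibreMap b₂ b₃ b₄ b₅ p‖) ^ (k + 2) * |C| := by gcongr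
    _ = _ := by rw [mul_pow]; ring

/-! ### Expansions and the cohomological equations -/

section Remainders

variable (a₂ a₃ a₄ a₅ : ℂ)

/-- The quotient by `z ^ 4` of the remainder of the expansion to order `3` of
`(1 + a₂ z + a₃ z ^ 2 + a₄ z ^ 3 + a₅ z ^ 4) ^ 2`. -/
noncomputable def squareTail (z : ℂ) : ℂ :=
  2 * a₅ + a₃ ^ 2 + 2 * (a₄ + a₅ * z) * (a₂ + a₃ * z) + z ^ 2 * (a₄ + a₅ * z) ^ 2

/-- The quotient by `z ^ 3` of the remainder of the expansion to order `2` of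
`(1 + a₂ z + a₃ z ^ 2 + a₄ z ^ 3 + a₅ z ^ 4) ^ 3`. -/
noncomputable def cubeTail (z : ℂ) : ℂ :=
  3 * (a₄ + a₅ * z) + 3 * (2 * a₂ * (a₃ + a₄ * z + a₅ * z ^ 2) +
    z * (a₃ + a₄ * z + a₅ * z ^ 2) ^ 2) + (a₂ + a₃ * z + a₄ * z ^ 2 + a₅ * z ^ 3) ^ 3

/-- The quotient by `z ^ 2` of the remainder of the expansion to order `1` of
`(1 + a₂ z + a₃ z ^ 2 + a₄ z ^ 3 + a₅ z ^ 4) ^ 4`. -/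
noncomputable def fourthTail (z : ℂ) : ℂ :=
  4 * (a₃ + a₄ * z + a₅ * z ^ 2) + (a₂ + a₃ * z + a₄ * z ^ 2 + a₅ * z ^ 3) ^ 2 *
    (6 + 4 * z * (a₂ + a₃ * z + a₄ * z ^ 2 + a₅ * z ^ 3) +
      z ^ 2 * (a₂ + a₃ * z + a₄ * z ^ 2 + a₅ * z ^ 3) ^ 2)

/-- The quotient by `z` of the remainder of the expansion to order `0` of
`(1 + a₂ z + a₃ z ^ 2 + a₄ z ^ 3 + a₅ z ^ 4) ^ 5`. -/
noncomputable def fifthTail (z : ℂ) : ℂ :=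
  ((1 + z * (a₂ + a₃ * z + a₄ * z ^ 2 + a₅ * z ^ 3)) ^ 4 +
    (1 + z * (a₂ + a₃ * z + a₄ * z ^ 2 + a₅ * z ^ 3)) ^ 3 +
    (1 + z * (a₂ + a₃ * z + a₄ * z ^ 2 + a₅ * z ^ 3)) ^ 2 +
    (1 + z * (a₂ + a₃ * z + a₄ * z ^ 2 + a₅ * z ^ 3)) + 1) *
    (a₂ + a₃ * z + a₄ * z ^ 2 + a₅ * z ^ 3)

lemma pow_two_eq_tail (z : ℂ) : (z + a₂ * z ^ 2 + a₃ * z ^ 3 + a₄ * z ^ 4 + a₅ * z ^ 5) ^ 2 =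
    z ^ 2 + 2 * a₂ * z ^ 3 + (a₂ ^ 2 + 2 * a₃) * z ^ 4 + (2 * a₄ + 2 * a₂ * a₃) * z ^ 5 +
      z ^ 6 * squareTail a₂ a₃ a₄ a₅ z := by
  unfold squareTail; ring

lemma pow_three_eq_tail (z : ℂ) : (z + a₂ * z ^ 2 + a₃ * z ^ 3 + a₄ * z ^ 4 + a₅ * z ^ 5) ^ 3 =
    z ^ 3 + 3 * a₂ * z ^ 4 + (3 * a₃ + 3 * a₂ ^ 2) * z ^ 5 +
      z ^ 6 * cubeTail a₂ a₃ a₄ a₅ z := by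
  unfold cubeTail; ring

lemma pow_four_eq_tail (z : ℂ) : (z + a₂ * z ^ 2 + a₃ * z ^ 3 + a₄ * z ^ 4 + a₅ * z ^ 5) ^ 4 =
    z ^ 4 + 4 * a₂ * z ^ 5 + z ^ 6 * fourthTail a₂ a₃ a₄ a₅ z := by
  unfold fourthTail; ring

lemma pow_five_eq_tail (z : ℂ) : (z + a₂ * z ^ 2 + a₃ * z ^ 3 + a₄ * z ^ 4 + a₅ * z ^ 5) ^ 5 =
    z ^ 5 + z ^ 6 * fifthTail a₂ a₃ a₄ a₅ z := by
  unfold fifthTail; ring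

end Remainders

/-- Solving the cohomological equations up to order `3` gives at least `3` petals. -/
lemma hasPetals_three {a₂ a₃ a₄ a₅ b₂ b₃ b₄ : C(UnitAddCircle, ℂ)} {α : ℝ} {A : ℂ} (hA : A ≠ 0)
    (h₂ : ∀ θ, a₂ θ + b₂ (θ + α) - b₂ θ = 0)
    (h₃ : ∀ θ, a₃ θ + 2 * b₂ (θ + α) * a₂ θ + b₃ (θ + α) - b₃ θ = 0)
    (h₄ : ∀ θ, a₄ θ + b₂ (θ + α) * (a₂ θ ^ 2 + 2 * a₃ θ) + 3 * b₃ (θ + α) * a₂ θ +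
      b₄ (θ + α) - b₄ θ = A) :
    HasPetals (fibredPolynomial a₂ a₃ a₄ a₅ α) 3 := by
  refine hasPetals_of_remainder (b₂ := b₂) (b₃ := b₃) (b₄ := b₄) (b₅ := 0) three_ne_zero hA
    (E := fun p => a₅ p.1 + b₂ (p.1 + α) * (2 * a₄ p.1 + 2 * a₂ p.1 * a₃ p.1 +
        p.2 * squareTail (a₂ p.1) (a₃ p.1) (a₄ p.1) (a₅ p.1) p.2) +
      b₃ (p.1 + α) * (3 * a₃ p.1 + 3 * a₂ p.1 ^ 2 +
        p.2 * cubeTail (a₂ p.1) (a₃ p.1) (a₄ p.1) (a₅ p.1) p.2) +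
      b₄ (p.1 + α) * (4 * a₂ p.1 + p.2 * fourthTail (a₂ p.1) (a₃ p.1) (a₄ p.1) (a₅ p.1) p.2) -
      A * (4 * b₂ p.1 + p.2 * fourthTail (b₂ p.1) (b₃ p.1) (b₄ p.1) 0 p.2)) ?_ fun p => ?_
  · unfold squareTail cubeTail fourthTail
    fun_prop
  · simp only [fibreMap, ContinuousMap.zero_apply, Nat.reduceAdd]
    rw [pow_two_eq_tail, pow_three_eq_tail, pow_four_eq_tail, pow_four_eq_tail]
    linear_combination p.2 ^ 2 * h₂ p.1 + p.2 ^ 3 * h₃ p.1 + p.2 ^ 4 * h₄ p.1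

/-- Solving the cohomological equations up to order `4` gives at least `4` petals. -/
lemma hasPetals_four {a₂ a₃ a₄ a₅ b₂ b₃ b₄ b₅ : C(UnitAddCircle, ℂ)} {α : ℝ} {A : ℂ} (hA : A ≠ 0)
    (h₂ : ∀ θ, a₂ θ + b₂ (θ + α) - b₂ θ = 0)
    (h₃ : ∀ θ, a₃ θ + 2 * b₂ (θ + α) * a₂ θ + b₃ (θ + α) - b₃ θ = 0)
    (h₄ : ∀ θ, a₄ θ + b₂ (θ + α) * (a₂ θ ^ 2 + 2 * a₃ θ) + 3 * b₃ (θ + α) * a₂ θ +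
      b₄ (θ + α) - b₄ θ = 0)
    (h₅ : ∀ θ, a₅ θ + b₂ (θ + α) * (2 * a₄ θ + 2 * a₂ θ * a₃ θ) +
      b₃ (θ + α) * (3 * a₃ θ + 3 * a₂ θ ^ 2) + 4 * b₄ (θ + α) * a₂ θ + b₅ (θ + α) - b₅ θ = A) :
    HasPetals (fibredPolynomial a₂ a₃ a₄ a₅ α) 4 := by
  refine hasPetals_of_remainder (b₂ := b₂) (b₃ := b₃) (b₄ := b₄) (b₅ := b₅) four_ne_zero hA
    (E := fun p => b₂ (p.1 + α) * squareTail (a₂ p.1) (a₃ p.1) (a₄ p.1) (a₅ p.1) p.2 +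
      b₃ (p.1 + α) * cubeTail (a₂ p.1) (a₃ p.1) (a₄ p.1) (a₅ p.1) p.2 +
      b₄ (p.1 + α) * fourthTail (a₂ p.1) (a₃ p.1) (a₄ p.1) (a₅ p.1) p.2 +
      b₅ (p.1 + α) * fifthTail (a₂ p.1) (a₃ p.1) (a₄ p.1) (a₅ p.1) p.2 -
      A * fifthTail (b₂ p.1) (b₃ p.1) (b₄ p.1) (b₅ p.1) p.2) ?_ fun p => ?_
  · unfold squareTail cubeTail fourthTail fifthTail
    fun_prop
  · simp only [fibreMap, Nat.reduceAdd]
    rw [pow_two_eq_tail, pow_three_eq_tail, pow_four_eq_tail, pow_five_eq_tail, pow_five_eq_tail]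
    linear_combination p.2 ^ 2 * h₂ p.1 + p.2 ^ 3 * h₃ p.1 + p.2 ^ 4 * h₄ p.1 + p.2 ^ 5 * h₅ p.1

/-! ### The example and its obstruction -/

section Example

lemma fourier_apply_add (n : ℤ) (θ α : UnitAddCircle) :
    (fourier n (θ + α) : ℂ) = fourier n θ * fourier n α := by
  simp only [fourier_apply, smul_add, AddCircle.toCircle_add, Circle.coe_mul]

lemma fourier_neg_one_mul (θ : UnitAddCircle) : (fourier 1 θ : ℂ) * fourier (-1) θ = 1 := by
  rw [← fourier_add]
  simp

/-- The divisors `1 - e(nα)` do not vanish. As only finitely many frequencies occur, no Diophantine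
condition on `α` is needed. -/
lemma fourier_one_pow_ne_one {α : ℝ} (hα : Irrational α) {n : ℕ} (hn : n ≠ 0) :
    (fourier 1 (α : UnitAddCircle) : ℂ) ^ n ≠ 1 := by
  rw [fourier_coe_apply, ← Complex.exp_nat_mul, Ne, Complex.exp_eq_one_iff]
  rintro ⟨m, hm⟩
  refine (hα.natCast_mul hn).ne_int m ?_
  have h1 : (2 * Real.pi * Complex.I : ℂ) * ((n : ℂ) * α) = (2 * Real.pi * Complex.I) * m := by
    push_cast at hm
    rw [div_one] at hm
    linear_combination hm
  have h2 := mul_left_cancel₀ Complex.two_pi_I_ne_zero h1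
  exact_mod_cast h2

variable {α : ℝ} {u : ℂ}

/-- The solutions of the cohomological equations of orders `2`, `3`, `4` for the example. -/
lemma exists_conjugacy (hα : Irrational α) (u : ℂ) : ∃ β δ ε ν : ℂ,
    let b₂ : C(UnitAddCircle, ℂ) := β • fourier 1
    let b₃ : C(UnitAddCircle, ℂ) := δ • fourier (-1) + ε • fourier 1 ^ 2
    let b₄ : C(UnitAddCircle, ℂ) := ν • fourier 1 ^ 3
    (∀ θ : UnitAddCircle, fourier 1 θ + b₂ (θ + α) - b₂ θ = 0) ∧
    (∀ θ : UnitAddCircle, fourier (-1) θ + 2 * b₂ (θ + α) * fourier 1 θ + b₃ (θ + α) - b₃ θ = 0) ∧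
    (∀ θ : UnitAddCircle, u + b₂ (θ + α) * (fourier 1 θ ^ 2 + 2 * fourier (-1) θ) +
      3 * b₃ (θ + α) * fourier 1 θ + b₄ (θ + α) - b₄ θ =
        u - 2 - (1 - fourier 1 (α : UnitAddCircle))⁻¹) := by
  have hp : ∀ n ≠ 0, 1 - (fourier 1 (α : UnitAddCircle) : ℂ) ^ n ≠ 0 := fun n hn =>
    sub_ne_zero.2 (fourier_one_pow_ne_one hα hn).symm
  have hμ := fourier_neg_one_mul (α : UnitAddCircle)
  have h1 := hp 1 one_ne_zero
  rw [pow_one] at h1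
  have h2 := hp 2 two_ne_zero
  have h3 := hp 3 three_ne_zero
  simp only [ContinuousMap.add_apply, ContinuousMap.smul_apply, ContinuousMap.pow_apply,
    smul_eq_mul, fourier_apply_add]
  set l : ℂ := fourier 1 (α : UnitAddCircle)
  set m : ℂ := fourier (-1) (α : UnitAddCircle)
  set β := (1 - l)⁻¹
  have hβ : β * (1 - l) = 1 := inv_mul_cancel₀ h1
  have hδ : -l * β * (1 - m) = 1 := by linear_combination hβ + β * hμ
  obtain ⟨ε, hε⟩ : ∃ ε, ε * (1 - l ^ 2) = 2 * β * l := ⟨_, div_mul_cancel₀ _ h2⟩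
  obtain ⟨ν, hν⟩ : ∃ ν, ν * (1 - l ^ 3) = β * l + 3 * l ^ 2 * ε := ⟨_, div_mul_cancel₀ _ h3⟩
  -- The frequencies to be cancelled are 1 at order 2, then -1 and 2, then 3. At order 4 the
  -- constant terms `u + 2βl + 3mδ` remain, with `δ = -lβ`; since `ml = 1` and `βl = β - 1` they
  -- equal `u - 2 - β`.
  refine ⟨β, -l * β, ε, ν, fun θ => ?_, fun θ => ?_, fun θ => ?_⟩
  · linear_combination (-fourier 1 θ : ℂ) * hβ
  · linear_combination (-fourier (-1) θ : ℂ) * hδ - (fourier 1 θ : ℂ) ^ 2 * hε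
  · have hxy := fourier_neg_one_mul θ
    linear_combination (2 * β * l + 3 * m * (-l * β)) * hxy - (fourier 1 θ : ℂ) ^ 3 * hν -
      3 * β * hμ - 2 * hβ

lemma hasPetals_three_of_irrational (hα : Irrational α)
    (hu : u - 2 - (1 - fourier 1 (α : UnitAddCircle))⁻¹ ≠ 0) :
    HasPetals (fibredPolynomial (fourier 1) (fourier (-1)) (.const _ u) (.const _ 1) α) 3 := by
  obtain ⟨β, δ, ε, ν, h₂, h₃, h₄⟩ := exists_conjugacy hα u
  exact hasPetals_three hu h₂ h₃ h₄

lemma hasPetals_four_of_irrational (hα : Irrational α)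
    (hu : u - 2 - (1 - fourier 1 (α : UnitAddCircle))⁻¹ = 0) :
    HasPetals (fibredPolynomial (fourier 1) (fourier (-1)) (.const _ u) (.const _ 1) α) 4 := by
  obtain ⟨β, δ, ε, ν, h₂, h₃, h₄⟩ := exists_conjugacy hα u
  rw [hu] at h₄
  have hp : ∀ n ≠ 0, 1 - (fourier 1 (α : UnitAddCircle) : ℂ) ^ n ≠ 0 := fun n hn =>
    sub_ne_zero.2 (fourier_one_pow_ne_one hα hn).symm
  have hμ := fourier_neg_one_mul (α : UnitAddCircle)
  have h1 := hp 1 one_ne_zero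
  rw [pow_one] at h1
  have h2 := hp 2 two_ne_zero
  have h4 := hp 4 four_ne_zero
  set l : ℂ := fourier 1 (α : UnitAddCircle) with hl
  set m : ℂ := fourier (-1) (α : UnitAddCircle) with hm
  have h2' : 1 - m ^ 2 ≠ 0 := fun h => h2 (by linear_combination -l ^ 2 * h - (l * m + 1) * hμ)
  obtain ⟨g₁, hg₁⟩ : ∃ g, g * (1 - l) = β * l * (2 * u + 2) + 3 * (m * δ + l ^ 2 * ε) :=
    ⟨_, div_mul_cancel₀ _ h1⟩
  obtain ⟨g₂, hg₂⟩ : ∃ g, g * (1 - m ^ 2) = 3 * m * δ := ⟨_, div_mul_cancel₀ _ h2'⟩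
  obtain ⟨g₄, hg₄⟩ : ∃ g, g * (1 - l ^ 4) = 3 * l ^ 2 * ε + 4 * ν * l ^ 3 :=
    ⟨_, div_mul_cancel₀ _ h4⟩
  -- At order 5 the products of lower coefficients have only the frequencies 1, -2 and 4, so the
  -- mean is `a₅ = 1`.
  refine hasPetals_four one_ne_zero h₂ h₃ h₄
    (b₅ := g₁ • fourier 1 + g₂ • fourier (-1) ^ 2 + g₄ • fourier 1 ^ 4) fun θ => ?_
  have hxy := fourier_neg_one_mul θ
  simp only [ContinuousMap.add_apply, ContinuousMap.smul_apply, ContinuousMap.pow_apply,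
    smul_eq_mul, fourier_apply_add, ContinuousMap.const_apply, ← hl, ← hm]
  linear_combination (2 * β * l + 3 * (m * δ + l ^ 2 * ε)) * (fourier 1 θ : ℂ) * hxy -
    (fourier 1 θ : ℂ) * hg₁ - (fourier (-1) θ : ℂ) ^ 2 * hg₂ - (fourier 1 θ : ℂ) ^ 4 * hg₄

lemma isTrigPolynomial_fourier (n : ℤ) : IsTrigPolynomial (fourier n) :=
  Submodule.subset_span (mem_range_self n)

lemma isTrigPolynomial_const (c : ℂ) : IsTrigPolynomial (.const _ c) := by
  have : (ContinuousMap.const UnitAddCircle c) = c • fourier 0 := by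
    ext θ
    simp
  rw [this]
  exact Submodule.smul_mem _ _ (isTrigPolynomial_fourier 0)

end Example

theorem mainTheorem5 :
    ∃ a₂ a₃ a₄ a₅ : C(UnitAddCircle, ℂ),
      IsTrigPolynomial a₂ ∧ IsTrigPolynomial a₃ ∧ IsTrigPolynomial a₄ ∧ IsTrigPolynomial a₅ ∧
      a₅ ≠ 0 ∧
      ∃ α₁ α₂ : ℝ, Irrational α₁ ∧ Irrational α₂ ∧
        (∀ k : ℕ, HasPetals (fibredPolynomial a₂ a₃ a₄ a₅ α₁) k ↔ k = 4) ∧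
        (∀ k : ℕ, HasPetals (fibredPolynomial a₂ a₃ a₄ a₅ α₂) k ↔ k = 3) := by
  have hα : Irrational (√2) := irrational_sqrt_two
  have hα' : Irrational (√2 + √2) := by
    have := hα.natCast_mul two_ne_zero
    rwa [Nat.cast_ofNat, two_mul] at this
  have hne : (fourier 1 ((√2 : ℝ) : UnitAddCircle) : ℂ) ≠ 1 := by
    simpa using fourier_one_pow_ne_one hα one_ne_zero
  refine ⟨fourier 1, fourier (-1),
    .const _ (2 + (1 - fourier 1 ((√2 : ℝ) : UnitAddCircle))⁻¹), .const _ 1,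
    isTrigPolynomial_fourier _, isTrigPolynomial_fourier _, isTrigPolynomial_const _,
    isTrigPolynomial_const _, fun h => one_ne_zero (DFunLike.congr_fun h 0), √2, √2 + √2, hα, hα',
    hasPetals_iff_of_hasPetals (hasPetals_four_of_irrational hα (by ring)),
    -- Were the obstruction to vanish at both rotation numbers, `l = e(√2)` would satisfy `l = l²`,
    -- as doubling the angle squares the character; then `l = 1`, contradicting irrationality.
    hasPetals_iff_of_hasPetals (hasPetals_three_of_irrational hα' fun h => hne ?_)⟩
  have h1 : (1 - fourier 1 ((√2 : ℝ) : UnitAddCircle) : ℂ)⁻¹ =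
      (1 - fourier 1 ((√2 + √2 : ℝ) : UnitAddCircle))⁻¹ := by linear_combination h
  have h2 := inv_injective h1
  rw [AddCircle.coe_add, fourier_apply_add] at h2
  have h3 : (fourier 1 ((√2 : ℝ) : UnitAddCircle) : ℂ) *
      (fourier 1 ((√2 : ℝ) : UnitAddCircle) - 1) = 0 := by linear_combination h2
  refine sub_eq_zero.1 ((mul_eq_zero.1 h3).resolve_left fun h0 => ?_)
  have := fourier_neg_one_mul ((√2 : ℝ) : UnitAddCircle)
  rw [h0, zero_mul] at this
  exact zero_ne_one this
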